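/- **Setting.** Let $D\subset\mathbb R^2$ be a bounded simply connected domain, and let $\lambda,\mu\in\mathbb R$ (Lamé constants) satisfy $\mu\ne0$, $\lambda+\mu\ne0$, $\lambda+2\mu\ne0$. Let $g_1,g_2:\partial D\to\mathbb R$ be given functions. For $f:D\to\mathbb R$ write $f\in C(\mathrm{cl}\,D)$ if $f$ is continuous in $D$ and has a finite limit from $D$ at each point of $\partial D$; boundary values are these limits. *Displacements.* The $(u_x,v_y)$-problem: find $u_x,v_y$ for displacements $(u,v)$, $u,v\in C^2(D)$, which satisfy in $D$ the Lamé system $\Delta u+\gamma\,\partial_x(u_x+v_y)=0$, $\Delta v+\gamma\,\partial_y(u_x+v_y)=0$, $\gamma=(\lambda+\mu)/\mu$, with $u_x=g_1$ and $v_y=g_2$ on $\partial D$. *Stress functions.* For $W:D\to\mathbb R$ put $$C_1[W]=-W_{xx}+\kappa_0\Delta W,\qquad C_2[W]=-W_{yy}+\kappa_0\Delta W,\qquad \kappa_0=\frac{\lambda+2\mu}{2(\lambda+\mu)} .$$ Let $\mathcal W$ be the set of biharmonic functions $W$ in $D$ with $W_{xx},W_{yy}\in C(\mathrm{cl}\,D)$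 and $C_k[W]=2\mu g_k$ on $\partial D$ for $k=1,2$. $W$ is an Airy stress function of $(u,v)$ if $(\lambda+2\mu)u_x+\lambda v_y=W_{yy}$, $\lambda u_x+(\lambda+2\mu)v_y=W_{xx}$ and $\mu(v_x+u_y)=-W_{xy}$ in $D$. *Monogenic functions.* Let $\mathbb B$ be the commutative $\mathbb C$-algebra with basis $e_1=1$, $e_2$ and $e_2^2=e_1+2ie_2$; put $\zeta=xe_1+ye_2$ and $D_\zeta=\{xe_1+ye_2:(x,y)\in D\}$. A function $\Phi:D_\zeta\to\mathbb B$ is monogenic if the limit of $(\Phi(\zeta+h)-\Phi(\zeta))h^{-1}$, as $h\to0$ in $\{xe_1+ye_2:x,y\in\mathbb R\}\setminus\{0\}$, exists at every $\zeta\in D_\zeta$. Write $\Phi=U_1e_1+U_2ie_1+U_3e_2+U_4ie_2$ with real $U_k=U_k[\Phi]$. The (1-4)-problem: find a monogenic $\Phi$ with $U_1,\dots,U_4\in C(\mathrm{cl}\,D)$ and, on $\partial D$, $U_1=u_1$, $U_4=u_4$, where $$u_1=\lambda g_1+(\lambda+2\mu)g_2,\qquad u_4=-\mu g_1+\mu g_2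 .$$ Call a monogenic $\Phi$ with these boundary values of $U_1$ and $U_4$ a *wide solution* if nothing is required of $U_2,U_3$ at $\partial D$. **Theorem 4.** 1. Every $W\in\mathcal W$ is an Airy stress function of some displacements $(u,v)$ solving the $(u_x,v_y)$-problem, and every solution $(u,v)$ of that problem has an Airy stress function $W\in\mathcal W$. For any $W\in\mathcal W$ and any solution $(u,v)$, in $\mathrm{cl}\,D$, $$2\mu u_x=C_1[W],\qquad 2\mu v_y=C_2[W].$$ 2. Let $\Phi$ be any solution of the (1-4)-problem. Then $\mathcal W\neq\emptyset$, and for every $W\in\mathcal W$, in $D$, $$W_{xx}=U_1[\Phi],\qquad W_{yy}=U_1[\Phi]-2U_4[\Phi].\tag{a}$$ The $(u_x,v_y)$-problem is solvable, and for each of its solutions $(u,v)$, in $\mathrm{cl}\,D$, $$2\mu u_x=\frac{\mu\,U_1[\Phi]-(\lambda+2\mu)\,U_4[\Phi]}{\lambda+\mu},\qquad 2\mu v_y=\frac{\mu\,U_1[\Phi]+\lambda\,U_4[\Phi]}{\lambda+\mu}.\tag{b}$$ 3. Conversely, for every $W\in\mathcal W$ there is a wide solution $\Phi$ with (a) in $D$,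 and for every solution $(u,v)$ of the $(u_x,v_y)$-problem there is a wide solution $\Phi$ with (b) in $\mathrm{cl}\,D$. -/

import Mathlib

open Filter Topology

noncomputable section

namespace Biharmonic

/-! ### The biharmonic algebra and monogenic functions -/

/-- The commutative complex algebra with basis `e₁ = 1`, `e₂`, where `e₂ ^ 2 = e₁ + 2 i e₂`.
An element `a e₁ + b e₂` (`a b : ℂ`) is stored as `⟨a, b⟩`. -/
abbrev BAlg : Type := QuadraticAlgebra ℂ 1 (2 * Complex.I)

/-- The topology of `ℂ × ℂ`, carried over by the coordinates in the basis `e₁, e₂`. -/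
instance : TopologicalSpace BAlg :=
  TopologicalSpace.induced (fun b : BAlg => (b.re, b.im)) inferInstance

/-- First basis element. -/
def e1 : BAlg := 1

/-- Second basis element. -/
def e2 : BAlg := ⟨0, 1⟩

theorem one_re : (1 : BAlg).re = 1 := rfl

theorem one_im : (1 : BAlg).im = 0 := rfl

theorem e2_sq : e2 ^ 2 = e1 + (2 * Complex.I) • e2 := by
  ext <;> simp [pow_two, e1, e2, one_re, one_im]

/-- The defining property of a biharmonic basis. -/
theorem biharmonic_basis : (e1 ^ 2 + e2 ^ 2) ^ 2 = 0 ∧ e1 ^ 2 + e2 ^ 2 ≠ 0 := by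
  constructor
  · ext <;> simp [pow_two, e1, e2, one_re, one_im] <;> ring_nf <;> simp
  · intro h
    have := congrArg QuadraticAlgebra.im h
    simp [pow_two, e1, e2, one_im] at this

/-- The point `ζ = x e₁ + y e₂` of the biharmonic plane. -/
def zeta (p : ℝ × ℝ) : BAlg := (p.1 : ℂ) • e1 + (p.2 : ℂ) • e2

/-- Nonzero elements of the biharmonic plane are invertible, so that `Ring.inverse` is the true
inverse in the difference quotient below. -/
theorem isUnit_zeta {p : ℝ × ℝ} (hp : p ≠ 0) : IsUnit (zeta p) := by
  set w : ℂ := (p.1 : ℂ) + p.2 * Complex.I with hw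
  have hw0 : w ≠ 0 := by
    intro h
    apply hp
    have h1 := congrArg Complex.re h
    have h2 := congrArg Complex.im h
    simp [hw] at h1 h2
    exact Prod.ext h1 h2
  refine IsUnit.of_mul_eq_one
    (⟨((p.1 : ℂ) + 2 * Complex.I * p.2) / w ^ 2, -(p.2 : ℂ) / w ^ 2⟩ : BAlg) ?_
  ext
  · simp [zeta, e1, e2, one_re, one_im]
    field_simp
    simp only [hw]
    ring_nf
    simp
    ring
  · simp [zeta, e1, e2, one_re, one_im]
    field_simp
    ring

/-- The domain `D_ζ` in the biharmonic plane congruent to `D`. -/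
def domZeta (D : Set (ℝ × ℝ)) : Set BAlg := zeta '' D

/-- `Φ` has the derivative `Φ'` at `ζ`: the limit of `(Φ (ζ + h) - Φ ζ) h⁻¹` as `h → 0` along
nonzero elements `h` of the biharmonic plane. -/
def HasBDerivAt (Φ : BAlg → BAlg) (Φ' ζ : BAlg) : Prop :=
  Tendsto (fun q : ℝ × ℝ => (Φ (ζ + zeta q) - Φ ζ) * Ring.inverse (zeta q)) (𝓝[≠] 0) (𝓝 Φ')

/-- `Φ` is monogenic in `D_ζ` (`D` is an open set). -/
def Monogenic (D : Set (ℝ × ℝ)) (Φ : BAlg → BAlg) : Prop :=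
  ∀ ζ ∈ domZeta D, ∃ Φ' : BAlg, HasBDerivAt Φ Φ' ζ

/-- The real component `U₁` in `Φ = U₁ e₁ + U₂ i e₁ + U₃ e₂ + U₄ i e₂`. -/
def U1 (Φ : BAlg → BAlg) (p : ℝ × ℝ) : ℝ := (Φ (zeta p)).re.re
/-- The component `U₂`. -/
def U2 (Φ : BAlg → BAlg) (p : ℝ × ℝ) : ℝ := (Φ (zeta p)).re.im
/-- The component `U₃`. -/
def U3 (Φ : BAlg → BAlg) (p : ℝ × ℝ) : ℝ := (Φ (zeta p)).im.re
/-- The component `U₄`. -/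
def U4 (Φ : BAlg → BAlg) (p : ℝ × ℝ) : ℝ := (Φ (zeta p)).im.im

/-! ### Functions on a plane domain -/

/-- Partial derivative `∂f/∂x`; it is only used at points of an open set where `f` is
differentiable. -/
def dx (f : ℝ × ℝ → ℝ) (p : ℝ × ℝ) : ℝ := fderiv ℝ f p (1, 0)
/-- Partial derivative `∂f/∂y`. -/
def dy (f : ℝ × ℝ → ℝ) (p : ℝ × ℝ) : ℝ := fderiv ℝ f p (0, 1)

/-- Two-dimensional Laplacian. -/
def lap (f : ℝ × ℝ → ℝ) (p : ℝ × ℝ) : ℝ := dx (dx f) p + dy (dy f) p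

/-- `f ∈ C(cl D)`: `f` is continuous in `D` and has a finite limit from `D` at each boundary
point. -/
def ContCl (D : Set (ℝ × ℝ)) (f : ℝ × ℝ → ℝ) : Prop :=
  ContinuousOn f D ∧ ∀ p ∈ frontier D, ∃ l : ℝ, Tendsto f (𝓝[D] p) (𝓝 l)

/-- The boundary values of `f` are given by `g`. -/
def HasBdryValues (D : Set (ℝ × ℝ)) (f g : ℝ × ℝ → ℝ) : Prop :=
  ∀ p ∈ frontier D, Tendsto f (𝓝[D] p) (𝓝 (g p))

/-- `W` is biharmonic in `D`. -/
def IsBiharmonic (D : Set (ℝ × ℝ)) (W : ℝ × ℝ → ℝ) : Prop :=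
  ContDiffOn ℝ 4 W D ∧
    ∀ p ∈ D, dx (dx (dx (dx W))) p + 2 * dx (dx (dy (dy W))) p + dy (dy (dy (dy W))) p = 0

/-! ### Plane elasticity -/

/-- `(u, v)` are displacements in elastic equilibrium (no body forces) of an isotropic body
occupying `D`: the Lamé system `Δu + γ θ_x = 0`, `Δv + γ θ_y = 0` with `θ = u_x + v_y` and
`γ = (λ + μ) / μ`. -/
def IsDisplacement (lam mu : ℝ) (D : Set (ℝ × ℝ)) (u v : ℝ × ℝ → ℝ) : Prop :=
  ContDiffOn ℝ 2 u D ∧ ContDiffOn ℝ 2 v D ∧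
    ∀ p ∈ D,
      lap u p + (lam + mu) / mu * dx (fun q => dx u q + dy v q) p = 0 ∧
      lap v p + (lam + mu) / mu * dy (fun q => dx u q + dy v q) p = 0

/-- The displacements `(u, v)` solve the `(u_x, v_y)`-problem with boundary data `g₁, g₂`. -/
def SolvesUxVy (lam mu : ℝ) (D : Set (ℝ × ℝ)) (g1 g2 u v : ℝ × ℝ → ℝ) : Prop :=
  IsDisplacement lam mu D u v ∧ HasBdryValues D (dx u) g1 ∧ HasBdryValues D (dy v) g2

/-- `W` is an Airy stress function of `(u, v)`: the stresses given by Hooke's law are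
`σ_x = W_yy`, `σ_y = W_xx`, `τ_xy = -W_xy`. -/
def IsAiry (lam mu : ℝ) (D : Set (ℝ × ℝ)) (u v W : ℝ × ℝ → ℝ) : Prop :=
  ∀ p ∈ D,
    (lam + 2 * mu) * dx u p + lam * dy v p = dy (dy W) p ∧
    lam * dx u p + (lam + 2 * mu) * dy v p = dx (dx W) p ∧
    mu * (dx v p + dy u p) = - dx (dy W) p

/-- `κ₀ = (λ + 2μ) / (2(λ + μ))`. -/
def kappa0 (lam mu : ℝ) : ℝ := (lam + 2 * mu) / (2 * (lam + mu))

/-- `C₁[W] = -W_xx + κ₀ ΔW`. -/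
def C1 (lam mu : ℝ) (W : ℝ × ℝ → ℝ) (p : ℝ × ℝ) : ℝ := - dx (dx W) p + kappa0 lam mu * lap W p

/-- `C₂[W] = -W_yy + κ₀ ΔW`. -/
def C2 (lam mu : ℝ) (W : ℝ × ℝ → ℝ) (p : ℝ × ℝ) : ℝ := - dy (dy W) p + kappa0 lam mu * lap W p

/-- `W` is biharmonic in `D`, its second derivatives `W_xx`, `W_yy` belong to `C(cl D)`, and
`C_k[W] = 2 μ g_k` on `∂D`. -/
def SolvesWProblem (lam mu : ℝ) (D : Set (ℝ × ℝ)) (g1 g2 W : ℝ × ℝ → ℝ) : Prop :=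
  IsBiharmonic D W ∧ ContCl D (dx (dx W)) ∧ ContCl D (dy (dy W)) ∧
    HasBdryValues D (C1 lam mu W) (fun p => 2 * mu * g1 p) ∧
    HasBdryValues D (C2 lam mu W) (fun p => 2 * mu * g2 p)

/-! ### The (1-4)-problem -/

/-- `Φ` is monogenic in `D_ζ` and its components `U₁`, `U₄` have the boundary values
`u₁`, `u₄`; nothing is required of `U₂`, `U₃` at the boundary. -/
def SolvesWide14 (D : Set (ℝ × ℝ)) (u1 u4 : ℝ × ℝ → ℝ) (Φ : BAlg → BAlg) : Prop :=
  Monogenic D Φ ∧ HasBdryValues D (U1 Φ) u1 ∧ HasBdryValues D (U4 Φ) u4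

/-- `Φ` solves the (1-4)-problem: `Φ` is monogenic in `D_ζ`, belongs to `C(cl D_ζ)`, and its
components `U₁`, `U₄` have the boundary values `u₁`, `u₄`. -/
def Solves14 (D : Set (ℝ × ℝ)) (u1 u4 : ℝ × ℝ → ℝ) (Φ : BAlg → BAlg) : Prop :=
  SolvesWide14 D u1 u4 Φ ∧
    ContCl D (U1 Φ) ∧ ContCl D (U2 Φ) ∧ ContCl D (U3 Φ) ∧ ContCl D (U4 Φ)

/-- Boundary data `u₁ = λ g₁ + (λ + 2μ) g₂`. -/
def data1 (lam mu : ℝ) (g1 g2 : ℝ × ℝ → ℝ) (p : ℝ × ℝ) : ℝ :=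
  lam * g1 p + (lam + 2 * mu) * g2 p

/-- Boundary data `u₄ = -μ g₁ + μ g₂`. -/
def data4 (mu : ℝ) (g1 g2 : ℝ × ℝ → ℝ) (p : ℝ × ℝ) : ℝ := -mu * g1 p + mu * g2 p

/-- `W_xx = U₁[Φ]` and `W_yy = U₁[Φ] - 2 U₄[Φ]` in `D`. -/
def SecondDerivs (D : Set (ℝ × ℝ)) (W : ℝ × ℝ → ℝ) (Φ : BAlg → BAlg) : Prop :=
  ∀ p ∈ D, dx (dx W) p = U1 Φ p ∧ dy (dy W) p = U1 Φ p - 2 * U4 Φ p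

/-- `2μ u_x = C₁[W]` and `2μ v_y = C₂[W]` in `cl D` (limit values on the boundary). -/
def RebuiltFromW (lam mu : ℝ) (D : Set (ℝ × ℝ)) (u v W : ℝ × ℝ → ℝ) : Prop :=
  ∀ p ∈ closure D,
    2 * mu * extendFrom D (dx u) p = extendFrom D (C1 lam mu W) p ∧
    2 * mu * extendFrom D (dy v) p = extendFrom D (C2 lam mu W) p

/-- The displacement derivatives expressed by `U₁[Φ]`, `U₄[Φ]` in `cl D` (limit values on the
boundary). -/
def RebuiltFromPhi (lam mu : ℝ) (D : Set (ℝ × ℝ)) (u v : ℝ × ℝ → ℝ) (Φ : BAlg → BAlg) : Prop :=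
  ∀ p ∈ closure D,
    2 * mu * extendFrom D (dx u) p =
      mu / (lam + mu) * extendFrom D (U1 Φ) p
        - (lam + 2 * mu) / (lam + mu) * extendFrom D (U4 Φ) p ∧
    2 * mu * extendFrom D (dy v) p =
      mu / (lam + mu) * extendFrom D (U1 Φ) p
        + lam / (lam + mu) * extendFrom D (U4 Φ) p

end Biharmonic

end

/-! Everything is compared through `W_xx` and `W_yy`. Write `γ = (λ + μ)/μ`.

Stress functions and displacements. Multiplied by `μ`, the Lamé system says that the stress tensor
is divergence free. This is the compatibility condition for the stresses to form a Hessian, so on a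
simply connected domain the Poincaré lemma yields `W` (`exists_of_hessian`,
`IsDisplacement.exists_airy`). Conversely, for biharmonic `W` the function `P = ΔW` is harmonic;
with a conjugate `Q` and an antiderivative `F + iG` of `P + iQ`, the pair `(-W_x + κ₀F, -W_y +
κ₀G)/(2μ)` is a displacement (`IsBiharmonic.exists_displacement`). The formulas for `u_x`, `v_y` are
Hooke's law inverted.

Uniqueness. The boundary data fix `W_xx` and `W_yy` on the boundary. For the difference `V` of two
stress functions, `ΔV` is harmonic with zero boundary values, hence zero; then `V_xx` is harmonic
with zero boundary values, hence zero (`IsBiharmonic.second_derivs_unique`). So all members of the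
class share these two derivatives.

Monogenic functions. For `Φ = A e₁ + B e₂`, monogeneity amounts to real differentiability with `A_y
= B_x` and `B_y = A_x + 2iB_x`. Then `U₁`, `U₃`, `U₁ - 2U₄` are compatible as `W_xx`, `W_xy`,
`W_yy`, and `ΔW = 2 Re(A + iB)` is harmonic because `A + iB` is holomorphic
(`Monogenic.exists_isBiharmonic`). In the other direction only `U₂` has to be found, and the
conjugate of `ΔW` supplies it (`IsBiharmonic.exists_monogenic`). This construction controls `U₁` and
`U₄` at the boundary, which is why the converse gives wide solutions. -/

noncomputable section

/-! ### The Poincaré lemma for 1-forms on simply connected open sets -/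

namespace Biharmonic

variable {X F : Type*} [TopologicalSpace X] [AddCommGroup F]

/-- A locally constant cocycle `f i - f j` defines a covering space of the base. -/
def cocycleCore [TopologicalSpace F] [DiscreteTopology F] {ι : Type*} (B : ι → Set X) (hB : ∀ i, IsOpen (B i)) (f : ι → X → F)
    (idx : X → ι) (hidx : ∀ x, x ∈ B (idx x))
    (hloc : ∀ i j, ∀ x ∈ B i ∩ B j, ∀ᶠ y in 𝓝 x, f i y - f j y = f i x - f j x) :
    FiberBundleCore ι X F where
  baseSet := B
  isOpen_baseSet := hB
  indexAt := idx
  mem_baseSet_at := hidx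
  coordChange i j x c := c + (f i x - f j x)
  coordChange_self i x _ c := by
    simp
  continuousOn_coordChange i j := by
    rintro ⟨x, c⟩ ⟨hx, -⟩
    have h : ∀ᶠ p : X × F in 𝓝 (x, c), p.2 + (f i p.1 - f j p.1) = c + (f i x - f j x) := by
      rw [nhds_prod_eq, nhds_discrete F, prod_pure, eventually_map]
      filter_upwards [hloc i j x hx] with y hy
      rw [hy]
    exact (continuousAt_const.congr (h.mono fun _ hp => hp.symm)).continuousWithinAt
  coordChange_comp i j k x _ v := by
    abel

/-- On a simply connected locally path connected space, local functions whose differences are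
locally constant can be glued up to additive constants. -/
theorem exists_glue [SimplyConnectedSpace X] [LocallyPathConnectedSpace X]
    {ι : Type*} (B : ι → Set X) (hB : ∀ i, IsOpen (B i)) (f : ι → X → F)
    (hcov : ∀ x, ∃ i, x ∈ B i)
    (hloc : ∀ i j, ∀ x ∈ B i ∩ B j, ∀ᶠ y in 𝓝 x, f i y - f j y = f i x - f j x) :
    ∃ g : X → F, ∀ i, ∀ x ∈ B i, ∀ᶠ y in 𝓝 x, g y - f i y = g x - f i x := by
  -- With discrete fibres the bundle of the cocycle is a covering, so the identity of the simply
  -- connected base lifts to a global section.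
  let _ : TopologicalSpace F := ⊥
  have : DiscreteTopology F := ⟨rfl⟩
  choose idx hidx using hcov
  let Z := cocycleCore B hB f idx hidx hloc
  have hcovmap : IsCoveringMap (Bundle.TotalSpace.proj : Z.TotalSpace → X) :=
    FiberBundle.isCoveringMap
  obtain ⟨x₀⟩ : Nonempty X := inferInstance
  obtain ⟨s, ⟨-, hs⟩, -⟩ := hcovmap.existsUnique_continuousMap_lifts (ContinuousMap.id X) x₀
    (⟨x₀, (0 : F)⟩ : Z.TotalSpace) rfl
  have hs' : ∀ x, (s x).proj = x := fun x => congrFun hs x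
  -- The coordinate in chart `i` stands for the candidate minus `f i`; adding `f` of the preferred
  -- chart back gives a value independent of the chart.
  let val : Z.TotalSpace → F := fun e => (show F from e.2) + f (idx e.1) e.1
  refine ⟨fun x => val (s x), fun i x hx => ?_⟩
  have hcont : ContinuousAt (fun y => (Z.localTriv i (s y)).2) x := by
    have h1 : ContinuousAt (Z.localTriv i) (s x) := by
      apply (Z.localTriv i).continuousAt
      rw [Z.mem_localTriv_source]
      change (s x).proj ∈ B i
      rwa [hs']
    exact continuous_snd.continuousAt.comp (h1.comp s.continuous.continuousAt)
  have hval : ∀ y, (val (s y) - f i y : F) = (Z.localTriv i (s y)).2 := by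
    intro y
    have : (Z.localTriv i (s y)).2 =
      ((show F from (s y).2) + (f (idx (s y).1) (s y).1 - f i (s y).1) : F) := rfl
    rw [this]
    have h2 : (s y).1 = y := hs' y
    simp only [val]
    rw [h2]
    abel
  have : ∀ᶠ y in 𝓝 x, (Z.localTriv i (s y)).2 = (Z.localTriv i (s x)).2 :=
    hcont.eventually_mem (isOpen_discrete {(Z.localTriv i (s x)).2} |>.mem_nhds rfl)
  filter_upwards [this] with y hy
  rw [hval, hval, hy]

/-- A closed differentiable 1-form on a simply connected open set is exact. -/
theorem exists_primitive_of_closed {E G : Type*} [NormedAddCommGroup E] [NormedSpace ℝ E]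
    [NormedAddCommGroup G] [NormedSpace ℝ G] [CompleteSpace G]
    {U : Set E} (hUo : IsOpen U) (hUs : IsSimplyConnected U) {ω : E → E →L[ℝ] G}
    (hω : DifferentiableOn ℝ ω U)
    (hsymm : ∀ a ∈ U, ∀ x y, fderiv ℝ ω a x y = fderiv ℝ ω a y x) :
    ∃ g : E → G, ∀ a ∈ U, HasFDerivAt g (ω a) a := by
  classical
  have := hUs.simplyConnectedSpace
  have := hUo.locallyPathConnectedSpace
  have hloc : ∀ a : U, ∃ r > 0, Metric.ball (a : E) r ⊆ U ∧
      ∃ f : E → G, ∀ b ∈ Metric.ball (a : E) r, HasFDerivAt f (ω b) b := by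
    intro a
    obtain ⟨r, hr, hrU⟩ := Metric.isOpen_iff.1 hUo a a.2
    exact ⟨r, hr, hrU, (convex_ball _ _).exists_forall_hasFDerivAt_of_fderiv_symmetric
      Metric.isOpen_ball (hω.mono hrU) fun b hb => hsymm b (hrU hb)⟩
  choose r hr hrU f hf using hloc
  obtain ⟨g, hg⟩ := exists_glue (X := U) (F := G) (fun a : U => Subtype.val ⁻¹' Metric.ball (a : E) (r a))
    (fun _ => Metric.isOpen_ball.preimage continuous_subtype_val)
    (fun a x => f a x) (fun x => ⟨x, Metric.mem_ball_self (hr x)⟩) (by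
      rintro i j x ⟨hi, hj⟩
      -- The intersection of two balls is convex, so two local primitives differ there by a single
      -- constant.
      have hconst : ∀ y ∈ Metric.ball (i : E) (r i) ∩ Metric.ball (j : E) (r j),
          f i y - f j y = f i x - f j x := by
        intro y hy
        refine (((convex_ball _ _).inter (convex_ball _ _)).is_const_of_fderivWithin_eq_zero
          (𝕜 := ℝ) (f := fun z => f i z - f j z) ?_ ?_ hy ⟨hi, hj⟩)
        · intro z hz
          exact ((hf i z hz.1).sub (hf j z hz.2)).differentiableAt.differentiableWithinAt
        · intro z hz
          rw [fderivWithin_of_isOpen (Metric.isOpen_ball.inter Metric.isOpen_ball) hz]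
          simpa using ((hf i z hz.1).fun_sub (hf j z hz.2)).fderiv
      have hopen : IsOpen (Subtype.val ⁻¹' (Metric.ball (i : E) (r i) ∩ Metric.ball (j : E) (r j)) :
          Set U) := (Metric.isOpen_ball.inter Metric.isOpen_ball).preimage continuous_subtype_val
      filter_upwards [hopen.mem_nhds ⟨hi, hj⟩] with y hy
      exact hconst y hy)
  refine ⟨fun x => if hx : x ∈ U then g ⟨x, hx⟩ else 0, fun a ha => ?_⟩
  have h1 := hg ⟨a, ha⟩ ⟨a, ha⟩ (Metric.mem_ball_self (hr _))
  have h2 := hf ⟨a, ha⟩ a (Metric.mem_ball_self (hr _))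
  set fa := f ⟨a, ha⟩
  refine (h2.add_const (g ⟨a, ha⟩ - fa a)).congr_of_eventuallyEq ?_
  rw [nhds_subtype_eq_comap, eventually_comap] at h1
  filter_upwards [h1, hUo.mem_nhds ha] with y hy hyU
  have := hy ⟨y, hyU⟩ rfl
  simp only [hyU, dif_pos]
  rw [← this]
  abel

/-! ### Partial derivatives on a plane domain -/

open ContinuousLinearMap

section Partials

variable {E : Type*} [NormedAddCommGroup E] [NormedSpace ℝ E] {D : Set (ℝ × ℝ)}

/-- `f` is differentiable in `D` with the partial derivatives `a` and `b`. -/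
def HasPartials (D : Set (ℝ × ℝ)) (f a b : ℝ × ℝ → E) : Prop :=
  ∀ p ∈ D, HasFDerivAt f ((fst ℝ ℝ ℝ).smulRight (a p) + (snd ℝ ℝ ℝ).smulRight (b p)) p

theorem smulRight_fst_add_snd (L : ℝ × ℝ →L[ℝ] E) :
    (fst ℝ ℝ ℝ).smulRight (L (1, 0)) + (snd ℝ ℝ ℝ).smulRight (L (0, 1)) = L := by
  ext <;> simp

namespace HasPartials

variable {f g a b a' b' : ℝ × ℝ → E}

theorem dx_eq {f a b : ℝ × ℝ → ℝ} (h : HasPartials D f a b) {p : ℝ × ℝ} (hp : p ∈ D) :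
    dx f p = a p := by
  simp [dx, (h p hp).fderiv]

theorem dy_eq {f a b : ℝ × ℝ → ℝ} (h : HasPartials D f a b) {p : ℝ × ℝ} (hp : p ∈ D) :
    dy f p = b p := by
  simp [dy, (h p hp).fderiv]

theorem of_differentiableOn {f : ℝ × ℝ → ℝ} (hD : IsOpen D) (h : DifferentiableOn ℝ f D) :
    HasPartials D f (dx f) (dy f) := by
  intro p hp
  have := (h.differentiableAt (hD.mem_nhds hp)).hasFDerivAt
  rwa [← smulRight_fst_add_snd (fderiv ℝ f p)] at this

theorem congr_partials (h : HasPartials D f a b) (ha : ∀ p ∈ D, a p = a' p)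
    (hb : ∀ p ∈ D, b p = b' p) : HasPartials D f a' b' := by
  intro p hp
  rw [← ha p hp, ← hb p hp]
  exact h p hp

theorem congr_fun (hD : IsOpen D) (h : HasPartials D f a b) (hg : ∀ p ∈ D, f p = g p) :
    HasPartials D g a b := by
  intro p hp
  refine (h p hp).congr_of_eventuallyEq ?_
  filter_upwards [hD.mem_nhds hp] with q hq using (hg q hq).symm

theorem differentiableOn (h : HasPartials D f a b) : DifferentiableOn ℝ f D :=
  fun p hp => (h p hp).differentiableAt.differentiableWithinAt

theorem const (c : E) : HasPartials D (fun _ => c) (fun _ => 0) (fun _ => 0) := by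
  intro p _
  refine (hasFDerivAt_const c p).congr_fderiv ?_
  ext <;> simp

theorem add (hf : HasPartials D f a b) (hg : HasPartials D g a' b') :
    HasPartials D (fun p => f p + g p) (fun p => a p + a' p) (fun p => b p + b' p) := by
  intro p hp
  convert! (hf p hp).fun_add (hg p hp) using 1
  ext <;> simp

theorem const_mul {A : Type*} [NormedCommRing A] [NormedAlgebra ℝ A] {f a b : ℝ × ℝ → A}
    (hf : HasPartials D f a b) (c : A) :
    HasPartials D (fun p => c * f p) (fun p => c * a p) (fun p => c * b p) := by
  intro p hp
  convert! (hf p hp).const_mul c using 1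
  ext <;> simp

theorem neg (hf : HasPartials D f a b) :
    HasPartials D (fun p => -f p) (fun p => -a p) (fun p => -b p) := by
  intro p hp
  convert! (hf p hp).fun_neg using 1
  ext <;> simp

theorem sub (hf : HasPartials D f a b) (hg : HasPartials D g a' b') :
    HasPartials D (fun p => f p - g p) (fun p => a p - a' p) (fun p => b p - b' p) := by
  intro p hp
  convert! (hf p hp).fun_sub (hg p hp) using 1
  ext <;> simp

theorem mul {A : Type*} [NormedCommRing A] [NormedAlgebra ℝ A] {f g a b a' b' : ℝ × ℝ → A}
    (hf : HasPartials D f a b) (hg : HasPartials D g a' b') :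
    HasPartials D (fun p => f p * g p) (fun p => f p * a' p + g p * a p)
      (fun p => f p * b' p + g p * b p) := by
  intro p hp
  convert! (hf p hp).fun_mul (hg p hp) using 1
  ext <;> simp

theorem fst_coord : HasPartials D Prod.fst (fun _ => (1 : ℝ)) (fun _ => 0) := by
  intro p _
  convert! hasFDerivAt_fst (𝕜 := ℝ) (p := p) using 1
  ext <;> simp

theorem snd_coord : HasPartials D Prod.snd (fun _ => (0 : ℝ)) (fun _ => 1) := by
  intro p _
  convert! hasFDerivAt_snd (𝕜 := ℝ) (p := p) using 1
  ext <;> simp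

theorem clm_comp {E' : Type*} [NormedAddCommGroup E'] [NormedSpace ℝ E'] (L : E →L[ℝ] E')
    (h : HasPartials D f a b) :
    HasPartials D (fun p => L (f p)) (fun p => L (a p)) (fun p => L (b p)) := by
  intro p hp
  convert! L.hasFDerivAt.comp p (h p hp) using 1
  ext <;> simp

theorem re {f a b : ℝ × ℝ → ℂ} (h : HasPartials D f a b) :
    HasPartials D (fun p => (f p).re) (fun p => (a p).re) (fun p => (b p).re) :=
  h.clm_comp Complex.reCLM

theorem im {f a b : ℝ × ℝ → ℂ} (h : HasPartials D f a b) :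
    HasPartials D (fun p => (f p).im) (fun p => (a p).im) (fun p => (b p).im) :=
  h.clm_comp Complex.imCLM

theorem ofReal {f a b : ℝ × ℝ → ℝ} (h : HasPartials D f a b) :
    HasPartials D (fun p => (f p : ℂ)) (fun p => (a p : ℂ)) (fun p => (b p : ℂ)) :=
  h.clm_comp Complex.ofRealCLM

theorem fderiv_eq (h : HasPartials D f a b) {p : ℝ × ℝ} (hp : p ∈ D) :
    fderiv ℝ f p = (fst ℝ ℝ ℝ).smulRight (a p) + (snd ℝ ℝ ℝ).smulRight (b p) :=
  (h p hp).fderiv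

theorem hasFDerivAt_form (ha : HasPartials D f a b) (hb : HasPartials D g a' b') {p : ℝ × ℝ}
    (hp : p ∈ D) :
    HasFDerivAt (fun q => (fst ℝ ℝ ℝ).smulRight (f q) + (snd ℝ ℝ ℝ).smulRight (g q))
      ((smulRightL ℝ (ℝ × ℝ) E (fst ℝ ℝ ℝ)).comp
          ((fst ℝ ℝ ℝ).smulRight (a p) + (snd ℝ ℝ ℝ).smulRight (b p)) +
        (smulRightL ℝ (ℝ × ℝ) E (snd ℝ ℝ ℝ)).comp
          ((fst ℝ ℝ ℝ).smulRight (a' p) + (snd ℝ ℝ ℝ).smulRight (b' p))) p :=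
  ((smulRightL ℝ (ℝ × ℝ) E (fst ℝ ℝ ℝ)).hasFDerivAt.comp p (ha p hp)).add
    ((smulRightL ℝ (ℝ × ℝ) E (snd ℝ ℝ ℝ)).hasFDerivAt.comp p (hb p hp))

/-- Mixed partial derivatives agree. -/
theorem mixed_eq {a₁ a₂ b₁ b₂ : ℝ × ℝ → E} (hD : IsOpen D) (h : HasPartials D f a b)
    (ha : HasPartials D a a₁ a₂) (hb : HasPartials D b b₁ b₂) {p : ℝ × ℝ} (hp : p ∈ D) :
    a₂ p = b₁ p := by
  have := second_derivative_symmetric_of_eventually (𝕜 := ℝ)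
    (hf := by filter_upwards [hD.mem_nhds hp] with q hq using h q hq)
    (hx := ha.hasFDerivAt_form hb hp) (0, 1) (1, 0)
  simpa using this

/-- The Poincaré lemma. -/
theorem exists_potential [CompleteSpace E] (hD : IsOpen D) (hs : IsSimplyConnected D)
    {a₁ c b₂ : ℝ × ℝ → E} (ha : HasPartials D a a₁ c) (hb : HasPartials D b c b₂) :
    ∃ f, HasPartials D f a b := by
  -- The form `a dx + b dy` is closed because `c` serves both as `a_y` and as `b_x`.
  refine exists_primitive_of_closed hD hs
    (fun p hp => (ha.hasFDerivAt_form hb hp).differentiableAt.differentiableWithinAt) ?_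
  intro p hp x y
  rw [(ha.hasFDerivAt_form hb hp).fderiv]
  simp only [add_apply, comp_apply, smulRightL_apply_apply, smulRight_apply, coe_fst', coe_snd',
    smul_add, smul_smul]
  rw [mul_comm x.1, mul_comm x.1, mul_comm x.2, mul_comm x.2]
  abel

theorem contDiffOn (hD : IsOpen D) {n : WithTop ℕ∞} (hn : n ≠ ⊤) (h : HasPartials D f a b)
    (ha : ContDiffOn ℝ n a D) (hb : ContDiffOn ℝ n b D) : ContDiffOn ℝ (n + 1) f D := by
  rw [contDiffOn_succ_iff_fderiv_of_isOpen hD]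
  -- The middle clause asks for analyticity when `n = ⊤`, the case that `hn` excludes.
  refine ⟨h.differentiableOn, fun h => absurd h hn, ?_⟩
  have : ContDiffOn ℝ n
      (fun q => (fst ℝ ℝ ℝ).smulRight (a q) + (snd ℝ ℝ ℝ).smulRight (b q)) D :=
    ((smulRightL ℝ (ℝ × ℝ) E (fst ℝ ℝ ℝ)).contDiff.comp_contDiffOn ha).add
      ((smulRightL ℝ (ℝ × ℝ) E (snd ℝ ℝ ℝ)).contDiff.comp_contDiffOn hb)
  exact this.congr fun p hp => h.fderiv_eq hp

end HasPartials

theorem contDiffOn_dx {f : ℝ × ℝ → ℝ} (hD : IsOpen D) {m n : WithTop ℕ∞} (h : ContDiffOn ℝ n f D)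
    (hmn : m + 1 ≤ n) : ContDiffOn ℝ m (dx f) D :=
  (h.fderiv_of_isOpen hD hmn).clm_apply contDiffOn_const

theorem contDiffOn_dy {f : ℝ × ℝ → ℝ} (hD : IsOpen D) {m n : WithTop ℕ∞} (h : ContDiffOn ℝ n f D)
    (hmn : m + 1 ≤ n) : ContDiffOn ℝ m (dy f) D :=
  (h.fderiv_of_isOpen hD hmn).clm_apply contDiffOn_const

theorem hasPartials_of_contDiffOn {f : ℝ × ℝ → ℝ} (hD : IsOpen D) {n : WithTop ℕ∞}
    (h : ContDiffOn ℝ n f D) (hn : n ≠ 0) : HasPartials D f (dx f) (dy f) :=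
  .of_differentiableOn hD (h.differentiableOn hn)

end Partials

/-! ### Holomorphic functions of `x + i y` -/

section Holomorphic

variable {D : Set (ℝ × ℝ)} {g c : ℝ × ℝ → ℂ}

/-- The relation `g_y = i g_x` makes the real derivative multiplication by `c`, which is complex
linear. -/
theorem HasPartials.hasDerivAt (h : HasPartials D g c fun p => Complex.I * c p) {z : ℂ}
    (hz : Complex.equivRealProdCLM z ∈ D) :
    HasDerivAt (fun w => g (Complex.equivRealProdCLM w)) (c (Complex.equivRealProdCLM z)) z := by
  have h1 : HasFDerivAt (fun w => g (Complex.equivRealProdCLM w))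
      ((toSpanSingleton ℂ (c (Complex.equivRealProdCLM z))).restrictScalars ℝ) z := by
    refine ((h _ hz).comp z Complex.equivRealProdCLM.hasFDerivAt).congr_fderiv ?_
    ext x
    have := Complex.re_add_im x
    simp
    linear_combination c (z.re, z.im) * this
  simpa using (hasFDerivAt_of_restrictScalars ℝ h1 rfl).hasDerivAt

theorem hasPartials_of_hasDerivAt {G G' : ℂ → ℂ}
    (h : ∀ z, Complex.equivRealProdCLM z ∈ D → HasDerivAt G (G' z) z) :
    HasPartials D (fun p => G (Complex.equivRealProdCLM.symm p))
      (fun p => G' (Complex.equivRealProdCLM.symm p))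
      (fun p => Complex.I * G' (Complex.equivRealProdCLM.symm p)) := by
  intro p hp
  have h1 := (h (Complex.equivRealProdCLM.symm p) (by simpa using hp)).hasFDerivAt.restrictScalars ℝ
  refine (h1.comp p Complex.equivRealProdCLM.symm.hasFDerivAt).congr_fderiv ?_
  ext <;> simp [Complex.equivRealProdCLM_symm_apply]

/-- A function with `g_y = i g_x` is smooth. -/
theorem HasPartials.contDiffOn_of_holomorphic (hD : IsOpen D)
    (h : HasPartials D g c fun p => Complex.I * c p) : ContDiffOn ℝ (⊤ : ℕ∞) g D := by
  have hO : IsOpen (Complex.equivRealProdCLM ⁻¹' D) :=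
    hD.preimage Complex.equivRealProdCLM.continuous
  have hd : DifferentiableOn ℂ (fun w => g (Complex.equivRealProdCLM w))
      (Complex.equivRealProdCLM ⁻¹' D) :=
    fun z hz => (h.hasDerivAt hz).differentiableAt.differentiableWithinAt
  have h1 : ContDiffOn ℂ (⊤ : ℕ∞) _ _ := hd.contDiffOn hO
  have h2 := (h1.restrict_scalars ℝ).comp Complex.equivRealProdCLM.symm.contDiff.contDiffOn
    (s := D) (fun p hp => by simpa using hp)
  exact h2.congr fun p _ => by simp

/-- The derivative of a holomorphic function is holomorphic. -/
theorem HasPartials.exists_deriv_of_holomorphic (hD : IsOpen D)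
    (h : HasPartials D g c fun p => Complex.I * c p) :
    ∃ c', HasPartials D c c' fun p => Complex.I * c' p := by
  have hO : IsOpen (Complex.equivRealProdCLM ⁻¹' D) :=
    hD.preimage Complex.equivRealProdCLM.continuous
  have hd : DifferentiableOn ℂ (fun w => g (Complex.equivRealProdCLM w))
      (Complex.equivRealProdCLM ⁻¹' D) :=
    fun z hz => (h.hasDerivAt hz).differentiableAt.differentiableWithinAt
  have h1 := hasPartials_of_hasDerivAt (D := D) (G := deriv fun w => g (Complex.equivRealProdCLM w))
    fun z hz => ((hd.deriv hO).differentiableAt (hO.mem_nhds hz)).hasDerivAt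
  refine ⟨_, h1.congr_fun hD fun p hp => ?_⟩
  rw [(h.hasDerivAt (by simpa using hp)).deriv]
  simp

end Holomorphic


/-! ### Second order partial derivatives -/

section SecondOrder

variable {D : Set (ℝ × ℝ)} {f g : ℝ × ℝ → ℝ}

theorem dx_congr (hD : IsOpen D) (h : ∀ p ∈ D, f p = g p) {p : ℝ × ℝ} (hp : p ∈ D) :
    dx f p = dx g p := by
  have : f =ᶠ[𝓝 p] g := by filter_upwards [hD.mem_nhds hp] with q hq using h q hq
  simp [dx, this.fderiv_eq]

theorem dy_congr (hD : IsOpen D) (h : ∀ p ∈ D, f p = g p) {p : ℝ × ℝ} (hp : p ∈ D) :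
    dy f p = dy g p := by
  have : f =ᶠ[𝓝 p] g := by filter_upwards [hD.mem_nhds hp] with q hq using h q hq
  simp [dy, this.fderiv_eq]

theorem lap_congr (hD : IsOpen D) (h : ∀ p ∈ D, f p = g p) {p : ℝ × ℝ} (hp : p ∈ D) :
    lap f p = lap g p := by
  rw [lap, lap, dx_congr hD (fun q hq => dx_congr hD h hq) hp,
    dy_congr hD (fun q hq => dy_congr hD h hq) hp]

theorem HasPartials.dx_dx_eq {a b a₁ a₂ : ℝ × ℝ → ℝ} (hD : IsOpen D) (h : HasPartials D f a b)
    (ha : HasPartials D a a₁ a₂) {p : ℝ × ℝ} (hp : p ∈ D) : dx (dx f) p = a₁ p := by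
  rw [dx_congr hD (fun q hq => h.dx_eq hq) hp, ha.dx_eq hp]

theorem HasPartials.dy_dy_eq {a b b₁ b₂ : ℝ × ℝ → ℝ} (hD : IsOpen D) (h : HasPartials D f a b)
    (hb : HasPartials D b b₁ b₂) {p : ℝ × ℝ} (hp : p ∈ D) : dy (dy f) p = b₂ p := by
  rw [dy_congr hD (fun q hq => h.dy_eq hq) hp, hb.dy_eq hp]

theorem HasPartials.dx_dy_eq {a b b₁ b₂ : ℝ × ℝ → ℝ} (hD : IsOpen D) (h : HasPartials D f a b)
    (hb : HasPartials D b b₁ b₂) {p : ℝ × ℝ} (hp : p ∈ D) : dx (dy f) p = b₁ p := by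
  rw [dx_congr hD (fun q hq => h.dy_eq hq) hp, hb.dx_eq hp]

theorem HasPartials.lap_eq {a b a₁ a₂ b₁ b₂ : ℝ × ℝ → ℝ} (hD : IsOpen D) (h : HasPartials D f a b)
    (ha : HasPartials D a a₁ a₂) (hb : HasPartials D b b₁ b₂) {p : ℝ × ℝ} (hp : p ∈ D) :
    lap f p = a₁ p + b₂ p := by
  rw [lap, h.dx_dx_eq hD ha hp, h.dy_dy_eq hD hb hp]

/-- Fixes the normal form of mixed derivatives, with `dy` applied first and `dx` last. -/
theorem hasPartials_dx (hD : IsOpen D) (h : ContDiffOn ℝ 2 f D) :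
    HasPartials D (dx f) (dx (dx f)) (dx (dy f)) := by
  have hf := hasPartials_of_contDiffOn hD h (by simp)
  have ha := hasPartials_of_contDiffOn hD (contDiffOn_dx hD (m := 1) h (by norm_num)) (by simp)
  have hb := hasPartials_of_contDiffOn hD (contDiffOn_dy hD (m := 1) h (by norm_num)) (by simp)
  exact ha.congr_partials (fun _ _ => rfl) fun p hp => hf.mixed_eq hD ha hb hp

theorem hasPartials_dy (hD : IsOpen D) (h : ContDiffOn ℝ 2 f D) :
    HasPartials D (dy f) (dx (dy f)) (dy (dy f)) :=
  hasPartials_of_contDiffOn hD (contDiffOn_dy hD (m := 1) h (by norm_num)) (by simp)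

theorem dy_dx_eq (hD : IsOpen D) (h : ContDiffOn ℝ 2 f D) {p : ℝ × ℝ} (hp : p ∈ D) :
    dy (dx f) p = dx (dy f) p :=
  (hasPartials_dx hD h).dy_eq hp

theorem contDiffOn_lap (hD : IsOpen D) {m n : WithTop ℕ∞} (h : ContDiffOn ℝ n f D)
    (hmn : m + 1 + 1 ≤ n) : ContDiffOn ℝ m (lap f) D :=
  (contDiffOn_dx hD (contDiffOn_dx hD h hmn) le_rfl).add
    (contDiffOn_dy hD (contDiffOn_dy hD h hmn) le_rfl)

theorem dy_dx_dx_eq (hD : IsOpen D) (h : ContDiffOn ℝ 3 f D) {p : ℝ × ℝ} (hp : p ∈ D) :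
    dy (dx (dx f)) p = dx (dx (dy f)) p := by
  rw [dy_dx_eq hD (contDiffOn_dx hD h (by norm_num)) hp]
  exact dx_congr hD (fun q hq => dy_dx_eq hD (h.of_le (by norm_num)) hq) hp

theorem dy_dy_dx_dx_eq (hD : IsOpen D) (h : ContDiffOn ℝ 4 f D) {p : ℝ × ℝ} (hp : p ∈ D) :
    dy (dy (dx (dx f))) p = dx (dx (dy (dy f))) p := by
  rw [dy_congr hD (fun q hq => dy_dx_dx_eq hD (h.of_le (by norm_num)) hq) hp]
  exact dy_dx_dx_eq hD (contDiffOn_dy hD h (by norm_num)) hp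

theorem dx_dx_lap_eq (hD : IsOpen D) (h : ContDiffOn ℝ 4 f D) {p : ℝ × ℝ} (hp : p ∈ D) :
    dx (dx (lap f)) p = lap (dx (dx f)) p := by
  have h1 : ContDiffOn ℝ 2 (dx (dx f)) D :=
    contDiffOn_dx hD (contDiffOn_dx hD (m := 3) h (by norm_num)) (by norm_num)
  have h2 : ContDiffOn ℝ 2 (dy (dy f)) D :=
    contDiffOn_dy hD (contDiffOn_dy hD (m := 3) h (by norm_num)) (by norm_num)
  have e1 : dx (dx (lap f)) p = dx (dx (dx (dx f))) p + dx (dx (dy (dy f))) p :=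
    ((hasPartials_of_contDiffOn hD h1 (by simp)).add
      (hasPartials_of_contDiffOn hD h2 (by simp))).dx_dx_eq hD
      ((hasPartials_dx hD h1).add (hasPartials_dx hD h2)) hp
  rw [e1, lap, dy_dy_dx_dx_eq hD h hp]

theorem dy_dy_lap_eq (hD : IsOpen D) (h : ContDiffOn ℝ 4 f D) {p : ℝ × ℝ} (hp : p ∈ D) :
    dy (dy (lap f)) p = dx (dx (dy (dy f))) p + dy (dy (dy (dy f))) p := by
  have h1 : ContDiffOn ℝ 2 (dx (dx f)) D :=
    contDiffOn_dx hD (contDiffOn_dx hD (m := 3) h (by norm_num)) (by norm_num)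
  have h2 : ContDiffOn ℝ 2 (dy (dy f)) D :=
    contDiffOn_dy hD (contDiffOn_dy hD (m := 3) h (by norm_num)) (by norm_num)
  have e1 : dy (dy (lap f)) p = dy (dy (dx (dx f))) p + dy (dy (dy (dy f))) p :=
    ((hasPartials_of_contDiffOn hD h1 (by simp)).add
      (hasPartials_of_contDiffOn hD h2 (by simp))).dy_dy_eq hD
      ((hasPartials_dy hD h1).add (hasPartials_dy hD h2)) hp
  rw [e1, dy_dy_dx_dx_eq hD h hp]

theorem lap_sub_eq (hD : IsOpen D) (hf : ContDiffOn ℝ 2 f D) (hg : ContDiffOn ℝ 2 g D)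
    {p : ℝ × ℝ} (hp : p ∈ D) : lap (fun q => f q - g q) p = lap f p - lap g p := by
  rw [((hasPartials_of_contDiffOn hD hf (by simp)).sub
    (hasPartials_of_contDiffOn hD hg (by simp))).lap_eq hD
    ((hasPartials_dx hD hf).sub (hasPartials_dx hD hg))
    ((hasPartials_dy hD hf).sub (hasPartials_dy hD hg)) hp, lap, lap]
  ring

/-- `W` is biharmonic if and only if `ΔW` is harmonic. -/
theorem isBiharmonic_iff (hD : IsOpen D) {W : ℝ × ℝ → ℝ} :
    IsBiharmonic D W ↔ ContDiffOn ℝ 4 W D ∧ ∀ p ∈ D, lap (lap W) p = 0 := by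
  refine and_congr_right fun h => forall₂_congr fun p hp => ?_
  have : lap (lap W) p = dx (dx (dx (dx W))) p + 2 * dx (dx (dy (dy W))) p
      + dy (dy (dy (dy W))) p := by
    rw [lap, dx_dx_lap_eq hD h hp, dy_dy_lap_eq hD h hp, lap, dy_dy_dx_dx_eq hD h hp]
    ring
  rw [this]

end SecondOrder

/-! ### Harmonic functions -/

section Harmonic

variable {D : Set (ℝ × ℝ)}

/-- Solutions of the Cauchy-Riemann equations are smooth. -/
theorem contDiffOn_of_cauchyRiemann (hD : IsOpen D) {f g a b : ℝ × ℝ → ℝ}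
    (hf : HasPartials D f a b) (hg : HasPartials D g (fun p => -b p) a) :
    ContDiffOn ℝ (⊤ : ℕ∞) f D ∧ ContDiffOn ℝ (⊤ : ℕ∞) g D := by
  have h := hf.ofReal.add (hg.ofReal.const_mul Complex.I)
  have hs := HasPartials.contDiffOn_of_holomorphic (D := D) hD (h.congr_partials (fun _ _ => rfl)
    (b' := fun p => Complex.I * ((a p : ℂ) + Complex.I * ((-b p : ℝ) : ℂ))) fun p _ => by
      push_cast
      linear_combination (b p : ℂ) * Complex.I_mul_I)
  constructor
  · exact (Complex.reCLM.contDiff.comp_contDiffOn hs).congr fun p _ => by simp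
  · exact (Complex.imCLM.contDiff.comp_contDiffOn hs).congr fun p _ => by simp

/-- Harmonic functions are smooth. -/
theorem contDiffOn_of_harmonic (hD : IsOpen D) {f a b a₁ c b₂ : ℝ × ℝ → ℝ}
    (hf : HasPartials D f a b) (ha : HasPartials D a a₁ c) (hb : HasPartials D b c b₂)
    (h : ∀ p ∈ D, a₁ p + b₂ p = 0) : ContDiffOn ℝ (⊤ : ℕ∞) f D := by
  obtain ⟨h1, h2⟩ := contDiffOn_of_cauchyRiemann hD ha
    (hb.neg.congr_partials (fun _ _ => rfl) fun p hp => by linarith [h p hp])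
  have := hf.contDiffOn hD (n := (⊤ : ℕ∞)) (by simp) h1 (by simpa using h2.neg)
  simpa using this

theorem contDiffOn_of_lap_eq_zero (hD : IsOpen D) {f : ℝ × ℝ → ℝ} (hf : ContDiffOn ℝ 2 f D)
    (h : ∀ p ∈ D, lap f p = 0) : ContDiffOn ℝ (⊤ : ℕ∞) f D :=
  contDiffOn_of_harmonic hD (hasPartials_of_contDiffOn hD hf (by simp)) (hasPartials_dx hD hf)
    (hasPartials_dy hD hf) h

/-! ### The maximum principle and uniqueness for the Dirichlet problem. -/

/-- If `c > 0`, the second derivative test makes `t` a local minimum as well, so `γ` is constant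
near `t` and `c = 0`. -/
theorem nonpos_of_isLocalMax {γ γ' : ℝ → ℝ} {t c : ℝ} (h : ∀ᶠ s in 𝓝 t, HasDerivAt γ (γ' s) s)
    (h' : HasDerivAt γ' c t) (hm : IsLocalMax γ t) : c ≤ 0 := by
  by_contra! hc
  have e : deriv γ =ᶠ[𝓝 t] γ' := h.mono fun s hs => hs.deriv
  have hmin : IsLocalMin γ t := isLocalMin_of_deriv_deriv_pos
    (by rw [e.deriv_eq, h'.deriv]; exact hc) hm.deriv_eq_zero h.self_of_nhds.continuousAt
  have hconst : γ =ᶠ[𝓝 t] fun _ => γ t := by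
    filter_upwards [hm, hmin] with s h1 h2 using le_antisymm h1 h2
  have h0 : deriv (deriv γ) t = 0 := by
    have := hconst.deriv.deriv_eq
    simpa using this
  rw [e.deriv_eq, h'.deriv] at h0
  exact hc.ne' h0

theorem HasPartials.hasDerivAt_fst {f a b : ℝ × ℝ → ℝ} (h : HasPartials D f a b) {x y : ℝ}
    (hp : (x, y) ∈ D) : HasDerivAt (fun t => f (t, y)) (a (x, y)) x := by
  have := (h (x, y) hp).comp_hasDerivAt x ((hasDerivAt_id x).prodMk (hasDerivAt_const x y))
  simpa using! this

theorem HasPartials.hasDerivAt_snd {f a b : ℝ × ℝ → ℝ} (h : HasPartials D f a b) {x y : ℝ}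
    (hp : (x, y) ∈ D) : HasDerivAt (fun t => f (x, t)) (b (x, y)) y := by
  have := (h (x, y) hp).comp_hasDerivAt y ((hasDerivAt_const y x).prodMk (hasDerivAt_id y))
  simpa using! this

theorem lap_nonpos_of_isLocalMax (hD : IsOpen D) {f a b a₁ a₂ b₁ b₂ : ℝ × ℝ → ℝ}
    (hf : HasPartials D f a b) (ha : HasPartials D a a₁ a₂) (hb : HasPartials D b b₁ b₂)
    {p : ℝ × ℝ} (hp : p ∈ D) (hm : IsLocalMax f p) : a₁ p + b₂ p ≤ 0 := by
  obtain ⟨x, y⟩ := p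
  have cx : Tendsto (fun t => (t, y)) (𝓝 x) (𝓝 (x, y)) :=
    (continuous_id.prodMk continuous_const).tendsto x
  have cy : Tendsto (fun t => (x, t)) (𝓝 y) (𝓝 (x, y)) :=
    (continuous_const.prodMk continuous_id).tendsto y
  have h1 : a₁ (x, y) ≤ 0 := nonpos_of_isLocalMax (γ := fun t => f (t, y))
    (by filter_upwards [cx (hD.mem_nhds hp)] with t ht using hf.hasDerivAt_fst ht)
    (ha.hasDerivAt_fst hp) (cx.eventually hm)
  have h2 : b₂ (x, y) ≤ 0 := nonpos_of_isLocalMax (γ := fun t => f (x, t))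
    (by filter_upwards [cy (hD.mem_nhds hp)] with t ht using hf.hasDerivAt_snd ht)
    (hb.hasDerivAt_snd hp) (cy.eventually hm)
  exact add_nonpos h1 h2

/-- Adding `ε(x² + y²)` makes the Laplacian equal to `4ε > 0`, which excludes interior maxima. For
small `ε` the boundary values stay below a supposed positive value `f p`, so the maximum over the
compact closure has nowhere to lie. -/
theorem harmonic_nonpos (hD : IsOpen D) (hDb : Bornology.IsBounded D)
    {f a b a₁ a₂ b₁ b₂ : ℝ × ℝ → ℝ}
    (hf : HasPartials D f a b) (ha : HasPartials D a a₁ a₂) (hb : HasPartials D b b₁ b₂)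
    (h : ∀ p ∈ D, a₁ p + b₂ p = 0) (hbd : ∀ p ∈ frontier D, Tendsto f (𝓝[D] p) (𝓝 0))
    {p : ℝ × ℝ} (hp : p ∈ D) : f p ≤ 0 := by
  by_contra! hpos
  have hcomp : IsCompact (closure D) := hDb.isCompact_closure
  let s : ℝ × ℝ → ℝ := fun q => q.1 * q.1 + q.2 * q.2
  have hs : Continuous s := by fun_prop
  have hs0 : ∀ q, 0 ≤ s q := fun q => add_nonneg (mul_self_nonneg _) (mul_self_nonneg _)
  obtain ⟨M, hM⟩ := (hcomp.image hs).bddAbove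
  have hM' : ∀ q ∈ closure D, s q ≤ M := fun q hq => hM ⟨q, hq, rfl⟩
  have hM0 : 0 ≤ M := (hs0 p).trans (hM' p (subset_closure hp))
  obtain ⟨ε, hε, hεM⟩ : ∃ ε > 0, ε * M < f p := by
    -- The denominator `M + 1` is positive even if `M = 0`, and `M / (M + 1) < 1`.
    refine ⟨f p / (M + 1), by positivity, ?_⟩
    rw [div_mul_eq_mul_div, div_lt_iff₀ (by positivity)]
    nlinarith
  let φ : ℝ × ℝ → ℝ := fun q => f q + ε * s q
  have hsp : HasPartials D s (fun q => 2 * q.1) (fun q => 2 * q.2) :=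
    ((HasPartials.fst_coord.mul .fst_coord).add (HasPartials.snd_coord.mul .snd_coord)).congr_partials
      (fun q _ => by ring) (fun q _ => by ring)
  have hφ := hf.add (hsp.const_mul ε)
  have hφx := ha.add ((HasPartials.fst_coord.const_mul 2).const_mul ε)
  have hφy := hb.add ((HasPartials.snd_coord.const_mul 2).const_mul ε)
  have hlim : ∀ q ∈ frontier D, Tendsto φ (𝓝[D] q) (𝓝 (ε * s q)) := fun q hq => by
    have := (hbd q hq).add ((hs.tendsto q).mono_left (nhdsWithin_le_nhds (s := D)) |>.const_mul ε)
    simpa using this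
  have hcontφ : ContinuousOn φ D := fun q hq => (hφ q hq).continuousAt.continuousWithinAt
  have hclos : ∀ q ∈ closure D, q ∈ D ∨ q ∈ frontier D := fun q hq => by
    rw [closure_eq_self_union_frontier] at hq
    exact hq
  have hcont : ContinuousOn (extendFrom D φ) (closure D) := by
    refine continuousOn_extendFrom subset_rfl fun q hq => ?_
    rcases hclos q hq with hq | hq
    · exact ⟨_, hcontφ q hq⟩
    · exact ⟨_, hlim q hq⟩
  have hD_eq : ∀ q ∈ D, extendFrom D φ q = φ q := fun q hq =>
    extendFrom_eq (subset_closure hq) (hcontφ q hq)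
  obtain ⟨q, hq, hmax⟩ := hcomp.exists_isMaxOn ⟨p, subset_closure hp⟩ hcont
  have hqp : f p ≤ extendFrom D φ q := by
    have h1 : extendFrom D φ p ≤ extendFrom D φ q := hmax (subset_closure hp)
    rw [hD_eq p hp] at h1
    have : 0 ≤ ε * s p := mul_nonneg hε.le (hs0 p)
    exact (le_add_of_nonneg_right this).trans h1
  rcases hclos q hq with hqD | hqF
  · have hloc : IsLocalMax φ q := by
      filter_upwards [hD.mem_nhds hqD] with r hr
      rw [← hD_eq r hr, ← hD_eq q hqD]
      exact hmax (subset_closure hr)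
    have := lap_nonpos_of_isLocalMax hD hφ hφx hφy hqD hloc
    linarith [h q hqD]
  · rw [extendFrom_eq hq (hlim q hqF)] at hqp
    have := mul_le_mul_of_nonneg_left (hM' q hq) hε.le
    linarith

/-- A harmonic function on a bounded domain with zero boundary values vanishes. -/
theorem eq_zero_of_harmonic (hD : IsOpen D) (hDb : Bornology.IsBounded D) {f : ℝ × ℝ → ℝ}
    (hf : ContDiffOn ℝ 2 f D) (h : ∀ p ∈ D, lap f p = 0)
    (hbd : ∀ p ∈ frontier D, Tendsto f (𝓝[D] p) (𝓝 0)) {p : ℝ × ℝ} (hp : p ∈ D) : f p = 0 := by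
  have h0 := hasPartials_of_contDiffOn hD hf (by simp)
  have h1 := hasPartials_dx hD hf
  have h2 := hasPartials_dy hD hf
  refine le_antisymm (harmonic_nonpos hD hDb h0 h1 h2 h hbd hp) ?_
  have := harmonic_nonpos hD hDb h0.neg h1.neg h2.neg
    (fun q hq => by have := h q hq; rw [lap] at this; linarith)
    (fun q hq => by simpa using (hbd q hq).neg) hp
  linarith

/-- The second derivatives of a biharmonic function are determined by the boundary values of
`W_xx` and `W_yy`. -/
theorem IsBiharmonic.second_derivs_unique (hD : IsOpen D) (hDb : Bornology.IsBounded D)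
    {W W' : ℝ × ℝ → ℝ} (hW : IsBiharmonic D W) (hW' : IsBiharmonic D W')
    (hxx : HasBdryValues D (fun p => dx (dx W) p - dx (dx W') p) fun _ => 0)
    (hyy : HasBdryValues D (fun p => dy (dy W) p - dy (dy W') p) fun _ => 0)
    {p : ℝ × ℝ} (hp : p ∈ D) : dx (dx W) p = dx (dx W') p ∧ dy (dy W) p = dy (dy W') p := by
  rw [isBiharmonic_iff hD] at hW hW'
  obtain ⟨c1, l1⟩ := hW
  obtain ⟨c2, l2⟩ := hW'
  have c1' : ContDiffOn ℝ 2 W D := c1.of_le (by norm_num)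
  have c2' : ContDiffOn ℝ 2 W' D := c2.of_le (by norm_num)
  let V : ℝ × ℝ → ℝ := fun q => W q - W' q
  have cV : ContDiffOn ℝ 4 V D := c1.sub c2
  have hV := (hasPartials_of_contDiffOn hD c1 (by simp)).sub
    (hasPartials_of_contDiffOn hD c2 (by simp))
  have exx : ∀ q ∈ D, dx (dx V) q = dx (dx W) q - dx (dx W') q := fun q hq =>
    hV.dx_dx_eq hD ((hasPartials_dx hD c1').sub (hasPartials_dx hD c2')) hq
  have eyy : ∀ q ∈ D, dy (dy V) q = dy (dy W) q - dy (dy W') q := fun q hq =>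
    hV.dy_dy_eq hD ((hasPartials_dy hD c1').sub (hasPartials_dy hD c2')) hq
  -- The Laplacian comes first: `V_xx` is known to be harmonic only after `ΔV` vanishes, by `Δ(V_xx)
  -- = (ΔV)_xx`.
  have hlapV : ∀ q ∈ D, lap V q = 0 := by
    intro q hq
    refine eq_zero_of_harmonic hD hDb (contDiffOn_lap hD cV (by norm_num)) (fun q hq => ?_)
      (fun q hq => ?_) hq
    · rw [lap_congr hD (fun r hr => lap_sub_eq hD c1' c2' hr) hq,
        lap_sub_eq hD (contDiffOn_lap hD c1 (by norm_num)) (contDiffOn_lap hD c2 (by norm_num)) hq,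
        l1 q hq, l2 q hq, sub_zero]
    · have := (hxx q hq).add (hyy q hq)
      rw [add_zero] at this
      refine this.congr' ?_
      filter_upwards [self_mem_nhdsWithin] with r hr
      rw [lap, exx r hr, eyy r hr]
  have hVxx : ∀ q ∈ D, dx (dx V) q = 0 := by
    intro q hq
    refine eq_zero_of_harmonic hD hDb
      (contDiffOn_dx hD (contDiffOn_dx hD (m := 3) cV (by norm_num)) (by norm_num))
      (fun q hq => ?_) (fun q hq => ?_) hq
    · rw [← dx_dx_lap_eq hD cV hq, dx_congr hD (fun r hr => dx_congr hD hlapV hr) hq]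
      simp [dx]
    · refine (hxx q hq).congr' ?_
      filter_upwards [self_mem_nhdsWithin] with r hr
      rw [exx r hr]
  have h1 := hVxx p hp
  have h2 := hlapV p hp
  rw [lap] at h2
  constructor
  · linarith [exx p hp]
  · linarith [eyy p hp]

end Harmonic


/-! ### Displacements and Airy stress functions -/

section Elasticity

variable {D : Set (ℝ × ℝ)}

theorem HasPartials.contDiffOn_top {f a b : ℝ × ℝ → ℝ} (hD : IsOpen D) (h : HasPartials D f a b)
    (ha : ContDiffOn ℝ (⊤ : ℕ∞) a D) (hb : ContDiffOn ℝ (⊤ : ℕ∞) b D) :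
    ContDiffOn ℝ (⊤ : ℕ∞) f D := by
  simpa using h.contDiffOn hD (n := (⊤ : ℕ∞)) (by simp) ha hb

/-- A harmonic function on a simply connected domain has a harmonic conjugate. -/
theorem exists_conjugate (hD : IsOpen D) (hs : IsSimplyConnected D) {P : ℝ × ℝ → ℝ}
    (hP : ContDiffOn ℝ 2 P D) (h : ∀ p ∈ D, lap P p = 0) :
    ∃ Q, HasPartials D Q (fun p => -dy P p) (dx P) := by
  refine HasPartials.exists_potential hD hs (hasPartials_dy hD hP).neg
    ((hasPartials_dx hD hP).congr_partials (fun p hp => ?_) fun _ _ => rfl)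
  have := h p hp
  rw [lap] at this
  linarith

/-- A field of symmetric matrices satisfying the compatibility conditions is a Hessian. -/
theorem exists_of_hessian (hD : IsOpen D) (hs : IsSimplyConnected D) {X T Y x₁ c₁ c₂ y₂ : ℝ × ℝ → ℝ}
    (hX : HasPartials D X x₁ c₁) (hT : HasPartials D T c₁ c₂) (hY : HasPartials D Y c₂ y₂)
    (sX : ContDiffOn ℝ (⊤ : ℕ∞) X D) (sT : ContDiffOn ℝ (⊤ : ℕ∞) T D)
    (sY : ContDiffOn ℝ (⊤ : ℕ∞) Y D) :
    ∃ W, ContDiffOn ℝ (⊤ : ℕ∞) W D ∧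
      ∀ p ∈ D, dx (dx W) p = X p ∧ dx (dy W) p = T p ∧ dy (dy W) p = Y p := by
  -- `G` and `H` are the future `W_x` and `W_y`; the common entry `T` makes `G dx + H dy` closed in
  -- turn.
  obtain ⟨G, hG⟩ := hX.exists_potential hD hs hT
  obtain ⟨H, hH⟩ := hT.exists_potential hD hs hY
  obtain ⟨W, hW⟩ := hG.exists_potential hD hs hH
  exact ⟨W, hW.contDiffOn_top hD (hG.contDiffOn_top hD sX sT) (hH.contDiffOn_top hD sT sY),
    fun p hp => ⟨hW.dx_dx_eq hD hG hp, hW.dx_dy_eq hD hH hp, hW.dy_dy_eq hD hH hp⟩⟩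

variable {lam mu : ℝ}

/-- Every biharmonic function on a simply connected domain is an Airy stress function. -/
theorem IsBiharmonic.exists_displacement (hmu : mu ≠ 0) (hlm : lam + mu ≠ 0) (hD : IsOpen D)
    (hs : IsSimplyConnected D) {W : ℝ × ℝ → ℝ} (hW : IsBiharmonic D W) :
    ∃ u v, IsDisplacement lam mu D u v ∧ IsAiry lam mu D u v W := by
  rw [isBiharmonic_iff hD] at hW
  obtain ⟨cW, lW⟩ := hW
  have cP : ContDiffOn ℝ 2 (lap W) D := contDiffOn_lap hD cW (by norm_num)
  have cWy : ContDiffOn ℝ 3 (dy W) D := contDiffOn_dy hD cW (by norm_num)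
  have cWxx : ContDiffOn ℝ 2 (dx (dx W)) D :=
    contDiffOn_dx hD (contDiffOn_dx hD (m := 3) cW (by norm_num)) (by norm_num)
  have cWxy : ContDiffOn ℝ 2 (dx (dy W)) D := contDiffOn_dx hD cWy (by norm_num)
  have cWyy : ContDiffOn ℝ 2 (dy (dy W)) D := contDiffOn_dy hD cWy (by norm_num)
  have hWx := hasPartials_dx hD (cW.of_le (by norm_num : (2 : WithTop ℕ∞) ≤ 4))
  have hWy := hasPartials_dy hD (cW.of_le (by norm_num : (2 : WithTop ℕ∞) ≤ 4))
  have hWxx := hasPartials_of_contDiffOn hD cWxx (by simp)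
  have hWxy := hasPartials_of_contDiffOn hD cWxy (by simp)
  have hWyy := hasPartials_of_contDiffOn hD cWyy (by simp)
  have hP := hasPartials_of_contDiffOn hD cP (by simp)
  have ePx : ∀ p ∈ D, dx (lap W) p = dx (dx (dx W)) p + dx (dy (dy W)) p := fun p hp =>
    (hWxx.add hWyy).dx_eq hp
  have ePy : ∀ p ∈ D, dy (lap W) p = dy (dx (dx W)) p + dy (dy (dy W)) p := fun p hp =>
    (hWxx.add hWyy).dy_eq hp
  have e1 : ∀ p ∈ D, dy (dx (dy W)) p = dx (dy (dy W)) p := fun p hp =>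
    dy_dx_eq hD (cWy.of_le (by norm_num)) hp
  have e2 : ∀ p ∈ D, dy (dx (dx W)) p = dx (dx (dy W)) p := fun p hp =>
    dy_dx_dx_eq hD (cW.of_le (by norm_num)) hp
  obtain ⟨Q, hQ⟩ := exists_conjugate hD hs cP lW
  have hQn : HasPartials D (fun p => -Q p) (dy (lap W)) fun p => -dx (lap W) p :=
    hQ.neg.congr_partials (fun _ _ => neg_neg _) fun _ _ => rfl
  -- `F + iG` is an antiderivative of `P + iQ`. Thus `F_x = G_y = P`, as the normal strains require,
  -- while `F_y + G_x = 0` leaves the shear strain untouched.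
  obtain ⟨F, hF⟩ := hP.exists_potential hD hs hQn
  obtain ⟨G, hG⟩ := hQ.exists_potential hD hs hP
  obtain ⟨sP, sQ⟩ := contDiffOn_of_cauchyRiemann hD hP hQ
  have sF : ContDiffOn ℝ 2 F D := (hF.contDiffOn_top hD sP sQ.neg).of_le (by norm_cast)
  have sG : ContDiffOn ℝ 2 G D := (hG.contDiffOn_top hD sQ sP).of_le (by norm_cast)
  obtain ⟨m, hm⟩ : ∃ m, 2 * mu * m = 1 := ⟨_, mul_inv_cancel₀ (by simpa using hmu)⟩
  obtain ⟨k, hk⟩ : ∃ k, k = kappa0 lam mu := ⟨_, rfl⟩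
  have hu := (hWx.neg.add (hF.const_mul k)).const_mul m
  have hv := (hWy.neg.add (hG.const_mul k)).const_mul m
  have hux := (hWxx.neg.add (hP.const_mul k)).const_mul m
  have huy := (hWxy.neg.add (hQn.const_mul k)).const_mul m
  have hvx := (hWxy.neg.add (hQ.const_mul k)).const_mul m
  have hvy := (hWyy.neg.add (hP.const_mul k)).const_mul m
  have hθ := (hux.add hvy).congr_fun hD fun p hp =>
    (congrArg₂ (· + ·) (hu.dx_eq hp) (hv.dy_eq hp)).symm
  -- Since `F` is harmonic, `Δu = -m P_x`, while `u_x + v_y = m(2κ₀ - 1)P`; this identity makes the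
  -- two terms of the Lamé equation cancel.
  have hk1 : (lam + mu) / mu * (2 * k - 1) = 1 := by
    rw [hk, kappa0]
    field_simp
    ring
  have hk2 : 2 * (lam + mu) * k = lam + 2 * mu := by
    rw [hk, kappa0]
    field_simp
  refine ⟨fun p => m * (-dx W p + k * F p), fun p => m * (-dy W p + k * G p),
    ⟨?_, ?_, fun p hp => ⟨?_, ?_⟩⟩, fun p hp => ⟨?_, ?_, ?_⟩⟩
  · exact contDiffOn_const.mul
      ((contDiffOn_dx hD cW (by norm_num)).neg.add (contDiffOn_const.mul sF))
  · exact contDiffOn_const.mul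
      ((contDiffOn_dy hD cW (by norm_num)).neg.add (contDiffOn_const.mul sG))
  · rw [hu.lap_eq hD hux huy hp, hθ.dx_eq hp]
    linear_combination m * ePx p hp - m * e1 p hp + m * dx (lap W) p * hk1
      + m * (lam + mu) / mu * ePx p hp
  · rw [hv.lap_eq hD hvx hvy hp, hθ.dy_eq hp]
    linear_combination m * ePy p hp + m * e2 p hp + m * dy (lap W) p * hk1
      + m * (lam + mu) / mu * ePy p hp
  · rw [hu.dx_eq hp, hv.dy_eq hp, lap]
    linear_combination m * (dx (dx W) p + dy (dy W) p) * hk2 + dy (dy W) p * hm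
  · rw [hu.dx_eq hp, hv.dy_eq hp, lap]
    linear_combination m * (dx (dx W) p + dy (dy W) p) * hk2 + dx (dx W) p * hm
  · rw [hv.dx_eq hp, hu.dy_eq hp]
    linear_combination -dx (dy W) p * hm

/-- Displacements are only `C²`, so regularity comes first. The Lamé system is the Cauchy-Riemann
system for `(1 + γ)θ` and the rotation `v_x - u_y`, so `θ` is smooth and harmonic. Then `u +
(γ/2)xθ` and `v + (γ/2)yθ` are harmonic, hence `u` and `v` are smooth. The stresses can now be
integrated to `W`, and `ΔW = 2(λ + μ)θ` is harmonic. -/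
theorem IsDisplacement.exists_airy (hmu : mu ≠ 0) (hl2m : lam + 2 * mu ≠ 0)
    (hD : IsOpen D) (hs : IsSimplyConnected D) {u v : ℝ × ℝ → ℝ}
    (h : IsDisplacement lam mu D u v) : ∃ W, IsBiharmonic D W ∧ IsAiry lam mu D u v W := by
  obtain ⟨cu, cv, hL⟩ := h
  have hu := hasPartials_of_contDiffOn hD cu (by simp)
  have hv := hasPartials_of_contDiffOn hD cv (by simp)
  have hθ := (hasPartials_dx hD cu).add (hasPartials_dy hD cv)
  have hω := (hasPartials_dx hD cv).sub (hasPartials_dy hD cu)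
  set g := (lam + mu) / mu with hg
  have hg1 : 1 + g ≠ 0 := by
    have : 1 + g = (lam + 2 * mu) / mu := by
      rw [hg]
      field_simp
      ring
    rw [this]
    exact div_ne_zero hl2m hmu
  have hL1 : ∀ p ∈ D, dx (dx u) p + dy (dy u) p + g * (dx (dx u) p + dx (dy v) p) = 0 :=
    fun p hp => by
      have := (hL p hp).1
      rwa [hθ.dx_eq hp, lap] at this
  have hL2 : ∀ p ∈ D, dx (dx v) p + dy (dy v) p + g * (dx (dy u) p + dy (dy v) p) = 0 :=
    fun p hp => by
      have := (hL p hp).2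
      rwa [hθ.dy_eq hp, lap] at this
  have hA := hθ.const_mul (1 + g)
  have hω' := hω.congr_partials
    (a' := fun p => -((1 + g) * (dx (dy u) p + dy (dy v) p)))
    (b' := fun p => (1 + g) * (dx (dx u) p + dx (dy v) p))
    (fun p hp => by linear_combination hL2 p hp) (fun p hp => by linear_combination -hL1 p hp)
  obtain ⟨sA, sω⟩ := contDiffOn_of_cauchyRiemann hD hA hω'
  set θ : ℝ × ℝ → ℝ := fun p => dx u p + dy v p with hθdef
  have sθ : ContDiffOn ℝ (⊤ : ℕ∞) θ D :=
    ((contDiffOn_const (c := (1 + g)⁻¹)).mul sA).congr fun p _ => by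
      rw [inv_mul_cancel_left₀ hg1]
  have cθ : ContDiffOn ℝ 2 θ D := sθ.of_le (by norm_cast)
  have hθ0 := hasPartials_of_contDiffOn hD cθ (by simp)
  have lθ : ∀ p ∈ D, lap θ p = 0 := by
    intro p hp
    have hω1 := hω'.congr_partials (a' := fun p => -((1 + g) * dy θ p))
      (b' := fun p => (1 + g) * dx θ p) (fun q hq => by rw [hθ.dy_eq hq])
      (fun q hq => by rw [hθ.dx_eq hq])
    -- Equality of the mixed derivatives of the rotation is `(1 + γ)Δθ = 0`.
    have := hω1.mixed_eq hD ((hasPartials_dy hD cθ).const_mul (1 + g)).neg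
      ((hasPartials_dx hD cθ).const_mul (1 + g)) hp
    have h0 : (1 + g) * lap θ p = 0 := by
      rw [lap]
      linear_combination -this
    exact (mul_eq_zero.1 h0).resolve_left hg1
  have su : ContDiffOn ℝ (⊤ : ℕ∞) u D := by
    have c1 : ContDiffOn ℝ (⊤ : ℕ∞) (fun p => g / 2 * (p.1 * θ p)) D :=
      contDiffOn_const.mul (contDiff_fst.contDiffOn.mul sθ)
    have h1 := hu.add ((HasPartials.fst_coord.mul hθ0).const_mul (g / 2))
    have h2 := (hasPartials_dx hD cu).add (((HasPartials.fst_coord.mul (hasPartials_dx hD cθ)).add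
      (hθ0.mul (.const 1))).const_mul (g / 2))
    have h3 := (hasPartials_dy hD cu).add (((HasPartials.fst_coord.mul (hasPartials_dy hD cθ)).add
      (hθ0.mul (.const 0))).const_mul (g / 2))
    -- `Δ(xθ) = 2θ_x` for harmonic `θ`, so the factor `γ/2` produces exactly the term `γθ_x` of the
    -- Lamé equation.
    have := contDiffOn_of_lap_eq_zero hD (cu.add (c1.of_le (by norm_cast))) fun p hp => by
      rw [h1.lap_eq hD h2 h3 hp]
      have e := lθ p hp
      rw [lap] at e
      have e1 := hθ.dx_eq hp
      linear_combination hL1 p hp + g / 2 * p.1 * e + g * e1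
    exact (this.sub c1).congr fun p _ => by ring
  have sv : ContDiffOn ℝ (⊤ : ℕ∞) v D := by
    have c1 : ContDiffOn ℝ (⊤ : ℕ∞) (fun p => g / 2 * (p.2 * θ p)) D :=
      contDiffOn_const.mul (contDiff_snd.contDiffOn.mul sθ)
    have h1 := hv.add ((HasPartials.snd_coord.mul hθ0).const_mul (g / 2))
    have h2 := (hasPartials_dx hD cv).add (((HasPartials.snd_coord.mul (hasPartials_dx hD cθ)).add
      (hθ0.mul (.const 0))).const_mul (g / 2))
    have h3 := (hasPartials_dy hD cv).add (((HasPartials.snd_coord.mul (hasPartials_dy hD cθ)).add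
      (hθ0.mul (.const 1))).const_mul (g / 2))
    have := contDiffOn_of_lap_eq_zero hD (cv.add (c1.of_le (by norm_cast))) fun p hp => by
      rw [h1.lap_eq hD h2 h3 hp]
      have e := lθ p hp
      rw [lap] at e
      have e1 := hθ.dy_eq hp
      linear_combination hL2 p hp + g / 2 * p.2 * e + g * e1
    exact (this.sub c1).congr fun p _ => by ring
  have hgm : mu * g = lam + mu := mul_div_cancel₀ _ hmu
  have sux : ContDiffOn ℝ (⊤ : ℕ∞) (dx u) D := contDiffOn_dx hD su (by simp)
  have suy : ContDiffOn ℝ (⊤ : ℕ∞) (dy u) D := contDiffOn_dy hD su (by simp)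
  have svx : ContDiffOn ℝ (⊤ : ℕ∞) (dx v) D := contDiffOn_dx hD sv (by simp)
  have svy : ContDiffOn ℝ (⊤ : ℕ∞) (dy v) D := contDiffOn_dy hD sv (by simp)
  have hX := ((hasPartials_dx hD cu).const_mul lam).add
    ((hasPartials_dy hD cv).const_mul (lam + 2 * mu))
  have hY := ((hasPartials_dx hD cu).const_mul (lam + 2 * mu)).add
    ((hasPartials_dy hD cv).const_mul lam)
  have hT := (((hasPartials_dx hD cv).add (hasPartials_dy hD cu)).const_mul mu).neg
  -- The equilibrium equations for the stresses, read as `(W_xy)_x = (W_xx)_y` and `(W_xy)_y =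
  -- (W_yy)_x`.
  have hTx : ∀ p ∈ D, -(mu * (dx (dx v) p + dx (dy u) p)) =
      lam * dx (dy u) p + (lam + 2 * mu) * dy (dy v) p := fun p hp => by
    linear_combination (dx (dy u) p + dy (dy v) p) * hgm - mu * hL2 p hp
  have hTy : ∀ p ∈ D, -(mu * (dx (dy v) p + dy (dy u) p)) =
      (lam + 2 * mu) * dx (dx u) p + lam * dx (dy v) p := fun p hp => by
    linear_combination (dx (dx u) p + dx (dy v) p) * hgm - mu * hL1 p hp
  obtain ⟨W, sW, hW⟩ := exists_of_hessian hD hs hX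
    (hT.congr_partials hTx hTy) hY
    ((contDiffOn_const.mul sux).add (contDiffOn_const.mul svy))
    (contDiffOn_const.mul (svx.add suy)).neg
    ((contDiffOn_const.mul sux).add (contDiffOn_const.mul svy))
  refine ⟨W, (isBiharmonic_iff hD).2 ⟨sW.of_le (by norm_cast), fun p hp => ?_⟩,
    fun p hp => ?_⟩
  · have e : ∀ q ∈ D, lap W q = 2 * (lam + mu) * θ q := fun q hq => by
      rw [lap, (hW q hq).1, (hW q hq).2.2]
      ring
    rw [lap_congr hD e hp, (hθ0.const_mul _).lap_eq hD ((hasPartials_dx hD cθ).const_mul _)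
      ((hasPartials_dy hD cθ).const_mul _) hp, ← mul_add]
    exact mul_eq_zero_of_right _ (lθ p hp)
  · obtain ⟨e1, e2, e3⟩ := hW p hp
    rw [e1, e2, e3]
    exact ⟨rfl, rfl, (neg_neg _).symm⟩

/-- Adding the normal stresses gives `κ₀ΔW = (λ + 2μ)(u_x + v_y)`; subtracting one of them isolates
`2μ` times one strain. -/
theorem IsAiry.rebuilt (hlm : lam + mu ≠ 0) {u v W : ℝ × ℝ → ℝ} (h : IsAiry lam mu D u v W)
    {p : ℝ × ℝ} (hp : p ∈ D) :
    2 * mu * dx u p = C1 lam mu W p ∧ 2 * mu * dy v p = C2 lam mu W p := by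
  obtain ⟨e1, e2, -⟩ := h p hp
  rw [C1, C2, lap, kappa0, ← e1, ← e2]
  constructor <;> field_simp <;> ring

end Elasticity


/-! ### Monogenic functions -/

section MonogenicFunctions

theorem zeta_re (p : ℝ × ℝ) : (zeta p).re = p.1 := by
  simp [zeta, e1, e2, one_re]

theorem zeta_im (p : ℝ × ℝ) : (zeta p).im = p.2 := by
  simp [zeta, e1, e2, one_im]

theorem zeta_add (p q : ℝ × ℝ) : zeta p + zeta q = zeta (p + q) := by
  ext <;> simp [zeta_re, zeta_im]

theorem tendsto_balg_iff {α : Type*} {l : Filter α} {f : α → BAlg} {b : BAlg} :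
    Tendsto f l (𝓝 b) ↔
      Tendsto (fun x => (f x).re) l (𝓝 b.re) ∧ Tendsto (fun x => (f x).im) l (𝓝 b.im) := by
  rw [nhds_induced, tendsto_comap_iff, Prod.tendsto_iff]
  rfl

/-- The inverse of `x e₁ + y e₂`. -/
def zetaInv (q : ℝ × ℝ) : BAlg :=
  ⟨((q.1 : ℂ) + 2 * Complex.I * q.2) / ((q.1 : ℂ) + q.2 * Complex.I) ^ 2,
    -(q.2 : ℂ) / ((q.1 : ℂ) + q.2 * Complex.I) ^ 2⟩

/-- Compares the maximum norm of the plane with the modulus of `x + iy`, whose square is the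
denominator in `zetaInv`. The bounds on `zetaInv` of order `1/‖q‖` follow from it. -/
theorem norm_le_norm_add_mul_I (q : ℝ × ℝ) : ‖q‖ ≤ ‖(q.1 : ℂ) + q.2 * Complex.I‖ := by
  rw [Prod.norm_def]
  refine max_le ?_ ?_
  · simpa using Complex.abs_re_le_norm ((q.1 : ℂ) + q.2 * Complex.I)
  · simpa using Complex.abs_im_le_norm ((q.1 : ℂ) + q.2 * Complex.I)

theorem add_mul_I_ne_zero {q : ℝ × ℝ} (hq : q ≠ 0) : (q.1 : ℂ) + q.2 * Complex.I ≠ 0 := by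
  rw [← norm_pos_iff]
  exact (norm_pos_iff.2 hq).trans_le (norm_le_norm_add_mul_I q)

theorem zeta_mul_zetaInv {q : ℝ × ℝ} (hq : q ≠ 0) : zeta q * zetaInv q = 1 := by
  have h := add_mul_I_ne_zero hq
  ext
  · simp only [QuadraticAlgebra.re_mul, zeta_re, zeta_im, zetaInv, one_re]
    rw [mul_div_assoc', mul_div_assoc', ← add_div, div_eq_one_iff_eq (pow_ne_zero 2 h)]
    linear_combination -(q.2 : ℂ) ^ 2 * Complex.I_mul_I
  · simp only [QuadraticAlgebra.im_mul, zeta_re, zeta_im, zetaInv, one_im]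
    field_simp
    ring

theorem inverse_zeta {q : ℝ × ℝ} (hq : q ≠ 0) : Ring.inverse (zeta q) = zetaInv q := by
  have h1 := Ring.inverse_mul_cancel _ (isUnit_zeta hq)
  calc Ring.inverse (zeta q) = Ring.inverse (zeta q) * (zeta q * zetaInv q) := by
        rw [zeta_mul_zetaInv hq, mul_one]
    _ = zetaInv q := by rw [← mul_assoc, h1, one_mul]

theorem norm_zetaInv_re_le {q : ℝ × ℝ} (hq : q ≠ 0) : ‖(zetaInv q).re‖ ≤ 3 / ‖q‖ := by
  have hq0 := norm_pos_iff.2 hq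
  have hw := norm_le_norm_add_mul_I q
  have h1 : ‖(q.1 : ℂ) + 2 * Complex.I * q.2‖ ≤ 3 * ‖q‖ := by
    refine (norm_add_le _ _).trans ?_
    have a1 : ‖(q.1 : ℂ)‖ ≤ ‖q‖ := by simpa using norm_fst_le q
    have a2 : ‖2 * Complex.I * (q.2 : ℂ)‖ ≤ 2 * ‖q‖ := by simpa using norm_snd_le q
    linarith
  rw [zetaInv, norm_div, norm_pow, div_le_div_iff₀ (pow_pos (hq0.trans_le hw) 2) hq0]
  nlinarith [mul_le_mul hw hw hq0.le (hq0.le.trans hw), mul_le_mul_of_nonneg_right h1 hq0.le]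

theorem norm_zetaInv_im_le {q : ℝ × ℝ} (hq : q ≠ 0) : ‖(zetaInv q).im‖ ≤ 1 / ‖q‖ := by
  have hq0 := norm_pos_iff.2 hq
  have hw := norm_le_norm_add_mul_I q
  have h1 : ‖-(q.2 : ℂ)‖ ≤ ‖q‖ := by simpa using norm_snd_le q
  rw [zetaInv, norm_div, norm_pow, div_le_div_iff₀ (pow_pos (hq0.trans_le hw) 2) hq0]
  nlinarith [mul_le_mul hw hw hq0.le (hq0.le.trans hw), mul_le_mul_of_nonneg_right h1 hq0.le]

/-! ### Monogeneity as real differentiability with Cauchy-Riemann conditions. -/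

/-- The remainder is `q.1 (a q - a₀) + q.2 (b q - b₀)`, which is `o(‖q‖)` because both brackets tend
to zero. -/
theorem hasFDerivAt_of_slopes {F : ℝ × ℝ → ℂ} {p : ℝ × ℝ} {a b : ℝ × ℝ → ℂ} {a₀ b₀ : ℂ}
    (h : ∀ q ≠ 0, F (p + q) - F p = q.1 * a q + q.2 * b q)
    (ha : Tendsto a (𝓝[≠] 0) (𝓝 a₀)) (hb : Tendsto b (𝓝[≠] 0) (𝓝 b₀)) :
    HasFDerivAt F ((fst ℝ ℝ ℝ).smulRight a₀ + (snd ℝ ℝ ℝ).smulRight b₀) p := by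
  rw [hasFDerivAt_iff_isLittleO_nhds_zero, Asymptotics.isLittleO_iff]
  intro ε hε
  have h1 := eventually_nhdsWithin_iff.1 (Metric.tendsto_nhds.1 ha (ε / 2) (by positivity))
  have h2 := eventually_nhdsWithin_iff.1 (Metric.tendsto_nhds.1 hb (ε / 2) (by positivity))
  filter_upwards [h1, h2] with q h1 h2
  by_cases hq : q = 0
  · simp [hq]
  have e : F (p + q) - F p - ((fst ℝ ℝ ℝ).smulRight a₀ + (snd ℝ ℝ ℝ).smulRight b₀) q =
      q.1 * (a q - a₀) + q.2 * (b q - b₀) := by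
    rw [h q hq]
    simp
    ring
  rw [e]
  have d1 : ‖a q - a₀‖ ≤ ε / 2 := by
    rw [← dist_eq_norm]
    exact (h1 hq).le
  have d2 : ‖b q - b₀‖ ≤ ε / 2 := by
    rw [← dist_eq_norm]
    exact (h2 hq).le
  have a1 : ‖(q.1 : ℂ)‖ ≤ ‖q‖ := by simpa using norm_fst_le q
  have a2 : ‖(q.2 : ℂ)‖ ≤ ‖q‖ := by simpa using norm_snd_le q
  calc _ ≤ ‖(q.1 : ℂ)‖ * ‖a q - a₀‖ + ‖(q.2 : ℂ)‖ * ‖b q - b₀‖ := by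
        rw [← norm_mul, ← norm_mul]
        exact norm_add_le _ _
    _ ≤ ‖q‖ * (ε / 2) + ‖q‖ * (ε / 2) := by gcongr
    _ = ε * ‖q‖ := by ring

/-- The Cauchy-Riemann conditions for monogenic functions. -/
theorem HasBDerivAt.hasFDerivAt {Φ : BAlg → BAlg} {Φ' : BAlg} {p : ℝ × ℝ}
    (h : HasBDerivAt Φ Φ' (zeta p)) :
    HasFDerivAt (fun p => (Φ (zeta p)).re)
      ((fst ℝ ℝ ℝ).smulRight Φ'.re + (snd ℝ ℝ ℝ).smulRight Φ'.im) p ∧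
    HasFDerivAt (fun p => (Φ (zeta p)).im) ((fst ℝ ℝ ℝ).smulRight Φ'.im +
      (snd ℝ ℝ ℝ).smulRight (Φ'.re + 2 * Complex.I * Φ'.im)) p := by
  rw [HasBDerivAt, tendsto_balg_iff] at h
  set S : ℝ × ℝ → BAlg :=
    fun q => (Φ (zeta p + zeta q) - Φ (zeta p)) * Ring.inverse (zeta q) with hS
  -- The coordinates of `S q * zeta q`, computed with `e₂² = e₁ + 2i e₂`, exhibit the slopes of both
  -- components of `Φ`.
  have hmul : ∀ q ≠ 0, Φ (zeta (p + q)) - Φ (zeta p) = S q * zeta q := fun q hq => by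
    rw [hS, mul_assoc, Ring.inverse_mul_cancel _ (isUnit_zeta hq), mul_one, zeta_add]
  constructor
  · refine hasFDerivAt_of_slopes (fun q hq => ?_) h.1 h.2
    have := congrArg QuadraticAlgebra.re (hmul q hq)
    simp only [QuadraticAlgebra.re_sub, QuadraticAlgebra.re_mul, zeta_re, zeta_im] at this
    rw [this]
    ring
  · refine hasFDerivAt_of_slopes (fun q hq => ?_) h.2 (h.1.add (h.2.const_mul _))
    have := congrArg QuadraticAlgebra.im (hmul q hq)
    simp only [QuadraticAlgebra.im_sub, QuadraticAlgebra.im_mul, zeta_re, zeta_im] at this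
    rw [this]
    ring

/-- The Cauchy-Riemann conditions and differentiability imply monogeneity. -/
theorem hasBDerivAt_of_hasFDerivAt {Φ : BAlg → BAlg} {a b : ℂ} {p : ℝ × ℝ}
    (h1 : HasFDerivAt (fun p => (Φ (zeta p)).re)
      ((fst ℝ ℝ ℝ).smulRight a + (snd ℝ ℝ ℝ).smulRight b) p)
    (h2 : HasFDerivAt (fun p => (Φ (zeta p)).im) ((fst ℝ ℝ ℝ).smulRight b +
      (snd ℝ ℝ ℝ).smulRight (a + 2 * Complex.I * b)) p) :
    HasBDerivAt Φ ⟨a, b⟩ (zeta p) := by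
  -- `R q` is `o(‖q‖)` and the inverse of `zeta q` is `O(1/‖q‖)`, so their product, the error of the
  -- difference quotient, tends to zero.
  set R : ℝ × ℝ → BAlg := fun q => Φ (zeta (p + q)) - Φ (zeta p) - ⟨a, b⟩ * zeta q with hR
  have lim : ∀ r : ℝ × ℝ → ℂ, (r =o[𝓝 0] fun q : ℝ × ℝ => q) →
      Tendsto (fun q => ‖r q‖ / ‖q‖) (𝓝[≠] 0) (𝓝 0) := fun r hr =>
    (hr.norm_norm.tendsto_div_nhds_zero).mono_left nhdsWithin_le_nhds
  have r1 := lim (fun q => (R q).re) (by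
    rw [hasFDerivAt_iff_isLittleO_nhds_zero] at h1
    refine h1.congr_left fun q => ?_
    simp only [hR, QuadraticAlgebra.re_sub, QuadraticAlgebra.re_mul, zeta_re, zeta_im]
    simp
    ring)
  have r2 := lim (fun q => (R q).im) (by
    rw [hasFDerivAt_iff_isLittleO_nhds_zero] at h2
    refine h2.congr_left fun q => ?_
    simp only [hR, QuadraticAlgebra.im_sub, QuadraticAlgebra.im_mul, zeta_re, zeta_im]
    simp
    ring)
  have hS : ∀ q ≠ 0, (Φ (zeta p + zeta q) - Φ (zeta p)) * Ring.inverse (zeta q) =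
      ⟨a, b⟩ + R q * zetaInv q := fun q hq => by
    have : Φ (zeta p + zeta q) - Φ (zeta p) = ⟨a, b⟩ * zeta q + R q := by
      rw [hR, zeta_add]
      ring
    rw [inverse_zeta hq, this, add_mul, mul_assoc, zeta_mul_zetaInv hq, mul_one]
  -- The factor 5 covers the worst coefficient: `‖(R q).im‖ / ‖q‖` enters the second coordinate with
  -- weight `3 + 2`.
  have hlim : Tendsto (fun q => 5 * (‖(R q).re‖ / ‖q‖) + 5 * (‖(R q).im‖ / ‖q‖)) (𝓝[≠] 0)
      (𝓝 0) := by
    simpa using (r1.const_mul 5).add (r2.const_mul 5)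
  have key : Tendsto (fun q => R q * zetaInv q) (𝓝[≠] 0) (𝓝 0) := by
    rw [tendsto_balg_iff]
    have bound : ∀ q : ℝ × ℝ, q ≠ 0 → ∀ c : ℂ, ‖c * (zetaInv q).re‖ ≤ 3 * (‖c‖ / ‖q‖) ∧
        ‖c * (zetaInv q).im‖ ≤ ‖c‖ / ‖q‖ := fun q hq c => by
      rw [norm_mul, norm_mul]
      constructor
      · calc _ ≤ ‖c‖ * (3 / ‖q‖) := by gcongr; exact norm_zetaInv_re_le hq
          _ = _ := by ring
      · calc _ ≤ ‖c‖ * (1 / ‖q‖) := by gcongr; exact norm_zetaInv_im_le hq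
          _ = _ := by ring
    constructor
    · refine squeeze_zero_norm' ?_ hlim
      filter_upwards [self_mem_nhdsWithin] with q hq
      obtain ⟨b1, -⟩ := bound q hq (R q).re
      obtain ⟨-, b4⟩ := bound q hq (R q).im
      rw [QuadraticAlgebra.re_mul, one_mul]
      have n1 : 0 ≤ ‖(R q).re‖ / ‖q‖ := by positivity
      have n2 : 0 ≤ ‖(R q).im‖ / ‖q‖ := by positivity
      exact (norm_add_le _ _).trans (by linarith)
    · refine squeeze_zero_norm' ?_ hlim
      filter_upwards [self_mem_nhdsWithin] with q hq
      obtain ⟨-, b2⟩ := bound q hq (R q).re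
      obtain ⟨b3, b4⟩ := bound q hq (R q).im
      rw [QuadraticAlgebra.im_mul]
      have n1 : 0 ≤ ‖(R q).re‖ / ‖q‖ := by positivity
      have n2 : 0 ≤ ‖(R q).im‖ / ‖q‖ := by positivity
      have e : ‖2 * Complex.I * (R q).im * (zetaInv q).im‖ ≤ 2 * (‖(R q).im‖ / ‖q‖) := by
        rw [mul_assoc, norm_mul]
        simpa using b4
      exact (norm_add₃_le).trans (by linarith)
  have hsum : Tendsto (fun q => (⟨a, b⟩ + R q * zetaInv q : BAlg)) (𝓝[≠] 0) (𝓝 ⟨a, b⟩) := by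
    rw [tendsto_balg_iff] at key ⊢
    exact ⟨by simpa using! key.1.const_add a, by simpa using! key.2.const_add b⟩
  refine hsum.congr' ?_
  filter_upwards [self_mem_nhdsWithin] with q hq
  exact (hS q hq).symm

/-! ### Monogenic functions and second derivatives of biharmonic functions. -/

variable {D : Set (ℝ × ℝ)} {Φ : BAlg → BAlg}

theorem Monogenic.exists_hasPartials (h : Monogenic D Φ) : ∃ a b : ℝ × ℝ → ℂ,
    HasPartials D (fun p => (Φ (zeta p)).re) a b ∧
    HasPartials D (fun p => (Φ (zeta p)).im) b (fun p => a p + 2 * Complex.I * b p) := by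
  have h' : ∀ p : ℝ × ℝ, ∃ Φ' : BAlg, p ∈ D → HasBDerivAt Φ Φ' (zeta p) := fun p => by
    by_cases hp : p ∈ D
    · obtain ⟨Φ', hΦ⟩ := h _ ⟨p, hp, rfl⟩
      exact ⟨Φ', fun _ => hΦ⟩
    · exact ⟨0, fun h => absurd h hp⟩
  choose Φ' hΦ using h'
  exact ⟨fun p => (Φ' p).re, fun p => (Φ' p).im, fun p hp => (hΦ p hp).hasFDerivAt.1,
    fun p hp => (hΦ p hp).hasFDerivAt.2⟩

theorem monogenic_of_hasPartials {a b : ℝ × ℝ → ℂ}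
    (h1 : HasPartials D (fun p => (Φ (zeta p)).re) a b)
    (h2 : HasPartials D (fun p => (Φ (zeta p)).im) b (fun p => a p + 2 * Complex.I * b p)) :
    Monogenic D Φ := by
  rintro _ ⟨p, hp, rfl⟩
  exact ⟨_, hasBDerivAt_of_hasFDerivAt (h1 p hp) (h2 p hp)⟩

/-- For a monogenic function `Φ = A e₁ + B e₂` the function `A + i B` is holomorphic. -/
theorem holomorphic_of_hasPartials {A B a b : ℝ × ℝ → ℂ} (hA : HasPartials D A a b)
    (hB : HasPartials D B b (fun p => a p + 2 * Complex.I * b p)) :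
    HasPartials D (fun p => A p + Complex.I * B p) (fun p => a p + Complex.I * b p)
      (fun p => Complex.I * (a p + Complex.I * b p)) :=
  (hA.add (hB.const_mul Complex.I)).congr_partials (fun _ _ => rfl) fun p _ => by
    linear_combination b p * Complex.I_mul_I

/-- The components of a monogenic function are smooth. -/
theorem contDiffOn_of_monogenic (hD : IsOpen D) {A B a b : ℝ × ℝ → ℂ} (hA : HasPartials D A a b)
    (hB : HasPartials D B b (fun p => a p + 2 * Complex.I * b p)) :
    ContDiffOn ℝ (⊤ : ℕ∞) A D ∧ ContDiffOn ℝ (⊤ : ℕ∞) B D := by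
  have hf := holomorphic_of_hasPartials hA hB
  obtain ⟨f₂, hf₂⟩ := hf.exists_deriv_of_holomorphic hD
  -- With `f = A + iB` and `f' = a + ib`, the function `B - y f'` is holomorphic. Hence `B = β + y
  -- f'` and `A = f - iB` are built from holomorphic functions and `y`.
  have hβ := hB.sub ((HasPartials.snd_coord (D := D)).ofReal.mul hf₂)
  have sβ := (hβ.congr_partials (fun _ _ => rfl)
    (b' := fun p => Complex.I * (b p - (p.2 * f₂ p + (a p + Complex.I * b p) * ((0 : ℝ) : ℂ))))
    fun p _ => by push_cast; ring).contDiffOn_of_holomorphic hD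
  have sy : ContDiffOn ℝ (⊤ : ℕ∞) (fun p : ℝ × ℝ => (p.2 : ℂ)) D :=
    Complex.ofRealCLM.contDiff.comp_contDiffOn contDiff_snd.contDiffOn
  have sB : ContDiffOn ℝ (⊤ : ℕ∞) B D :=
    (sβ.add (sy.mul (hf₂.contDiffOn_of_holomorphic hD))).congr fun p _ => by ring
  exact ⟨((hf.contDiffOn_of_holomorphic hD).sub (contDiffOn_const.mul sB)).congr
    fun p _ => by ring, sB⟩

/-- A monogenic function represents the second derivatives of some biharmonic function. -/
theorem Monogenic.exists_isBiharmonic (hD : IsOpen D) (hs : IsSimplyConnected D)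
    (h : Monogenic D Φ) : ∃ W, IsBiharmonic D W ∧ SecondDerivs D W Φ := by
  obtain ⟨a, b, hA, hB⟩ := h.exists_hasPartials
  obtain ⟨sA, sB⟩ := contDiffOn_of_monogenic hD hA hB
  have hU1 : HasPartials D (U1 Φ) _ _ := hA.re
  have hU3 : HasPartials D (U3 Φ) _ _ := hB.re
  have hU4 : HasPartials D (U4 Φ) _ _ := hB.im
  have s1 : ContDiffOn ℝ (⊤ : ℕ∞) (U1 Φ) D := Complex.reCLM.contDiff.comp_contDiffOn sA
  have s3 : ContDiffOn ℝ (⊤ : ℕ∞) (U3 Φ) D := Complex.reCLM.contDiff.comp_contDiffOn sB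
  have s4 : ContDiffOn ℝ (⊤ : ℕ∞) (U4 Φ) D := Complex.imCLM.contDiff.comp_contDiffOn sB
  -- The mixed derivative is `U₃`: the Cauchy-Riemann conditions give `(U₁)_y = (U₃)_x` and `(U₃)_y
  -- = (U₁ - 2U₄)_x`.
  obtain ⟨W, sW, hW⟩ := exists_of_hessian hD hs hU1 hU3
    ((hU1.sub (hU4.const_mul 2)).congr_partials (fun p _ => by simp [sub_eq_add_neg]) fun _ _ => rfl)
    s1 s3 (s1.sub (contDiffOn_const.mul s4))
  refine ⟨W, (isBiharmonic_iff hD).2 ⟨sW.of_le (by norm_cast), fun p hp => ?_⟩,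
    fun p hp => ⟨(hW p hp).1, (hW p hp).2.2⟩⟩
  have hf := holomorphic_of_hasPartials hA hB
  obtain ⟨f₂, hf₂⟩ := hf.exists_deriv_of_holomorphic hD
  have e : ∀ q ∈ D, lap W q = 2 * ((Φ (zeta q)).re + Complex.I * (Φ (zeta q)).im).re := by
    intro q hq
    rw [lap, (hW q hq).1, (hW q hq).2.2]
    simp [U1, U4]
    ring
  rw [lap_congr hD e hp, (hf.re.const_mul 2).lap_eq hD (hf₂.re.const_mul 2)
    ((hf₂.const_mul Complex.I).re.const_mul 2) hp]
  simp

/-- The second derivatives of a biharmonic function are represented by a monogenic function. -/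
theorem IsBiharmonic.exists_monogenic (hD : IsOpen D) (hs : IsSimplyConnected D) {W : ℝ × ℝ → ℝ}
    (hW : IsBiharmonic D W) : ∃ Φ, Monogenic D Φ ∧ SecondDerivs D W Φ := by
  rw [isBiharmonic_iff hD] at hW
  obtain ⟨cW, lW⟩ := hW
  have cP : ContDiffOn ℝ 2 (lap W) D := contDiffOn_lap hD cW (by norm_num)
  have cWy : ContDiffOn ℝ 3 (dy W) D := contDiffOn_dy hD cW (by norm_num)
  have cWxx : ContDiffOn ℝ 2 (dx (dx W)) D :=
    contDiffOn_dx hD (contDiffOn_dx hD (m := 3) cW (by norm_num)) (by norm_num)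
  have cWxy : ContDiffOn ℝ 2 (dx (dy W)) D := contDiffOn_dx hD cWy (by norm_num)
  have cWyy : ContDiffOn ℝ 2 (dy (dy W)) D := contDiffOn_dy hD cWy (by norm_num)
  have hWxx := hasPartials_of_contDiffOn hD cWxx (by simp)
  have hWxy := hasPartials_of_contDiffOn hD cWxy (by simp)
  have hWyy := hasPartials_of_contDiffOn hD cWyy (by simp)
  have ePx : ∀ p ∈ D, dx (lap W) p = dx (dx (dx W)) p + dx (dy (dy W)) p := fun p hp =>
    (hWxx.add hWyy).dx_eq hp
  have ePy : ∀ p ∈ D, dy (lap W) p = dy (dx (dx W)) p + dy (dy (dy W)) p := fun p hp =>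
    (hWxx.add hWyy).dy_eq hp
  have e1 : ∀ p ∈ D, dy (dx (dy W)) p = dx (dy (dy W)) p := fun p hp =>
    dy_dx_eq hD (cWy.of_le (by norm_num)) hp
  have e2 : ∀ p ∈ D, dy (dx (dx W)) p = dx (dx (dy W)) p := fun p hp =>
    dy_dx_dx_eq hD (cW.of_le (by norm_num)) hp
  obtain ⟨Q, hQ⟩ := exists_conjugate hD hs cP lW
  -- `U₁`, `U₃`, `U₄` are dictated by the Hessian. The choice `U₂ = Q/2 - W_xy` makes `A + iB = (ΔW
  -- + iQ)/2` holomorphic.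
  let A : ℝ × ℝ → ℂ := fun p => (dx (dx W) p : ℂ) +
    Complex.I * ((2⁻¹ * Q p - dx (dy W) p : ℝ) : ℂ)
  let B : ℝ × ℝ → ℂ := fun p => (dx (dy W) p : ℂ) +
    Complex.I * ((2⁻¹ * (dx (dx W) p - dy (dy W) p) : ℝ) : ℂ)
  -- The real parts of the two coordinates recover `(x, y)` from `zeta (x, y)`; values off the
  -- biharmonic plane are immaterial.
  let Φ : BAlg → BAlg := fun z => ⟨A (z.re.re, z.im.re), B (z.re.re, z.im.re)⟩
  have hΦ : ∀ p, Φ (zeta p) = ⟨A p, B p⟩ := fun p => by simp [Φ, zeta_re, zeta_im]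
  have hA := hWxx.ofReal.add (((hQ.const_mul 2⁻¹).sub hWxy).ofReal.const_mul Complex.I)
  have hB := hWxy.ofReal.add (((hWxx.sub hWyy).const_mul 2⁻¹).ofReal.const_mul Complex.I)
  refine ⟨Φ, monogenic_of_hasPartials
    (a := fun p => (dx (dx (dx W)) p : ℂ) +
      Complex.I * ((2⁻¹ * -dy (lap W) p - dx (dx (dy W)) p : ℝ) : ℂ))
    (b := fun p => (dx (dx (dy W)) p : ℂ) +
      Complex.I * ((2⁻¹ * (dx (dx (dx W)) p - dx (dy (dy W)) p) : ℝ) : ℂ)) ?_ ?_,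
    fun p hp => ⟨?_, ?_⟩⟩
  · simp only [hΦ]
    refine hA.congr_partials (fun _ _ => rfl) fun p hp => ?_
    rw [e2 p hp, e1 p hp, ePx p hp]
    congr 3
    ring
  · simp only [hΦ]
    refine hB.congr_partials (fun _ _ => rfl) fun p hp => ?_
    rw [e2 p hp, e1 p hp, ePy p hp, e2 p hp]
    push_cast
    linear_combination (-1 : ℂ) * (dx (dx (dx W)) p - dx (dy (dy W)) p) * Complex.I_mul_I
  · simp [U1, hΦ, A]
  · simp [U1, U4, hΦ, A, B]

end MonogenicFunctions


/-! ### Boundary values -/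

section Boundary

variable {D : Set (ℝ × ℝ)}

theorem HasBdryValues.congr {f f' g g' : ℝ × ℝ → ℝ} (h : HasBdryValues D f g)
    (hf : ∀ p ∈ D, f p = f' p) (hg : ∀ p, g p = g' p) : HasBdryValues D f' g' := by
  intro p hp
  rw [← hg p]
  refine (h p hp).congr' ?_
  filter_upwards [self_mem_nhdsWithin] with q hq using hf q hq

theorem HasBdryValues.linear {f₁ f₂ g₁ g₂ : ℝ × ℝ → ℝ} (h₁ : HasBdryValues D f₁ g₁)
    (h₂ : HasBdryValues D f₂ g₂) (a b : ℝ) :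
    HasBdryValues D (fun p => a * f₁ p + b * f₂ p) fun p => a * g₁ p + b * g₂ p :=
  fun p hp => ((h₁ p hp).const_mul a).add ((h₂ p hp).const_mul b)

theorem HasBdryValues.contCl {f g : ℝ × ℝ → ℝ} (h : HasBdryValues D f g) (hf : ContinuousOn f D) :
    ContCl D f :=
  ⟨hf, fun p hp => ⟨_, h p hp⟩⟩

theorem ContCl.congr {f f' : ℝ × ℝ → ℝ} (h : ContCl D f) (hf : ∀ p ∈ D, f p = f' p) :
    ContCl D f' := by
  refine ⟨h.1.congr fun p hp => (hf p hp).symm, fun p hp => ?_⟩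
  obtain ⟨l, hl⟩ := h.2 p hp
  refine ⟨l, hl.congr' ?_⟩
  filter_upwards [self_mem_nhdsWithin] with q hq using hf q hq

theorem ContCl.linear {f₁ f₂ : ℝ × ℝ → ℝ} (h₁ : ContCl D f₁) (h₂ : ContCl D f₂) (a b : ℝ) :
    ContCl D fun p => a * f₁ p + b * f₂ p := by
  refine ⟨(h₁.1.const_mul a).add (h₂.1.const_mul b), fun p hp => ?_⟩
  obtain ⟨l₁, hl₁⟩ := h₁.2 p hp
  obtain ⟨l₂, hl₂⟩ := h₂.2 p hp
  exact ⟨_, (hl₁.const_mul a).add (hl₂.const_mul b)⟩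

theorem ContCl.exists_tendsto {f : ℝ × ℝ → ℝ} (h : ContCl D f) {p : ℝ × ℝ} (hp : p ∈ closure D) :
    ∃ l, Tendsto f (𝓝[D] p) (𝓝 l) := by
  rw [closure_eq_self_union_frontier] at hp
  rcases hp with hp | hp
  · exact ⟨_, h.1 p hp⟩
  · exact h.2 p hp

/-- Linear relations between functions in `C(cl D)` extend to the closure. -/
theorem ContCl.extendFrom_linear {f f₁ f₂ : ℝ × ℝ → ℝ} (h₁ : ContCl D f₁) (h₂ : ContCl D f₂)
    {c a b : ℝ} (hc : c ≠ 0) (h : ∀ p ∈ D, c * f p = a * f₁ p + b * f₂ p) {p : ℝ × ℝ}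
    (hp : p ∈ closure D) :
    c * extendFrom D f p = a * extendFrom D f₁ p + b * extendFrom D f₂ p := by
  obtain ⟨l₁, hl₁⟩ := h₁.exists_tendsto hp
  obtain ⟨l₂, hl₂⟩ := h₂.exists_tendsto hp
  have hf : Tendsto f (𝓝[D] p) (𝓝 (c⁻¹ * (a * l₁ + b * l₂))) := by
    refine (((hl₁.const_mul a).add (hl₂.const_mul b)).const_mul c⁻¹).congr' ?_
    filter_upwards [self_mem_nhdsWithin] with q hq
    rw [← h q hq, inv_mul_cancel_left₀ hc]
  rw [extendFrom_eq hp hl₁, extendFrom_eq hp hl₂, extendFrom_eq hp hf, mul_inv_cancel_left₀ hc]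

end Boundary

/-! ### The boundary value problems -/

section Problems

variable {D : Set (ℝ × ℝ)} {lam mu : ℝ} {g1 g2 u v W : ℝ × ℝ → ℝ} {Φ : BAlg → BAlg}

/-- Hooke's law with `C₁[W]/(2μ)` and `C₂[W]/(2μ)` in place of the strains. It turns the data for
`C₁`, `C₂` into data for `W_xx` and `W_yy`. -/
theorem dx_dx_eq_of_C (hlm : lam + mu ≠ 0) (hmu : mu ≠ 0) (W : ℝ × ℝ → ℝ) (p : ℝ × ℝ) :
    lam / (2 * mu) * C1 lam mu W p + (lam + 2 * mu) / (2 * mu) * C2 lam mu W p = dx (dx W) p := by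
  rw [C1, C2, lap, kappa0]
  field_simp
  ring

theorem dy_dy_eq_of_C (hlm : lam + mu ≠ 0) (hmu : mu ≠ 0) (W : ℝ × ℝ → ℝ) (p : ℝ × ℝ) :
    (lam + 2 * mu) / (2 * mu) * C1 lam mu W p + lam / (2 * mu) * C2 lam mu W p = dy (dy W) p := by
  rw [C1, C2, lap, kappa0]
  field_simp
  ring

theorem SolvesWProblem.bdry_dx_dx (hlm : lam + mu ≠ 0) (hmu : mu ≠ 0)
    (h : SolvesWProblem lam mu D g1 g2 W) :
    HasBdryValues D (dx (dx W)) fun p => lam * g1 p + (lam + 2 * mu) * g2 p :=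
  (h.2.2.2.1.linear h.2.2.2.2 _ _).congr (fun p _ => dx_dx_eq_of_C hlm hmu W p)
    fun p => by field_simp

theorem SolvesWProblem.bdry_dy_dy (hlm : lam + mu ≠ 0) (hmu : mu ≠ 0)
    (h : SolvesWProblem lam mu D g1 g2 W) :
    HasBdryValues D (dy (dy W)) fun p => (lam + 2 * mu) * g1 p + lam * g2 p :=
  (h.2.2.2.1.linear h.2.2.2.2 _ _).congr (fun p _ => dy_dy_eq_of_C hlm hmu W p)
    fun p => by field_simp

theorem SolvesWProblem.second_derivs_unique (hlm : lam + mu ≠ 0) (hmu : mu ≠ 0) (hD : IsOpen D)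
    (hDb : Bornology.IsBounded D) {W' : ℝ × ℝ → ℝ} (h : SolvesWProblem lam mu D g1 g2 W)
    (h' : SolvesWProblem lam mu D g1 g2 W') {p : ℝ × ℝ} (hp : p ∈ D) :
    dx (dx W) p = dx (dx W') p ∧ dy (dy W) p = dy (dy W') p :=
  h.1.second_derivs_unique hD hDb h'.1
    (((h.bdry_dx_dx hlm hmu).linear (h'.bdry_dx_dx hlm hmu) 1 (-1)).congr (fun _ _ => by ring)
      fun _ => by ring)
    (((h.bdry_dy_dy hlm hmu).linear (h'.bdry_dy_dy hlm hmu) 1 (-1)).congr (fun _ _ => by ring)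
      fun _ => by ring) hp

theorem IsBiharmonic.continuousOn_dx_dx (hD : IsOpen D) (h : IsBiharmonic D W) :
    ContinuousOn (dx (dx W)) D :=
  (contDiffOn_dx hD (m := 2) (contDiffOn_dx hD (m := 3) h.1 (by norm_num))
    (by norm_num)).continuousOn

theorem IsBiharmonic.continuousOn_dy_dy (hD : IsOpen D) (h : IsBiharmonic D W) :
    ContinuousOn (dy (dy W)) D :=
  (contDiffOn_dy hD (m := 2) (contDiffOn_dy hD (m := 3) h.1 (by norm_num))
    (by norm_num)).continuousOn

/-- A biharmonic function whose second derivatives have the right boundary values belongs to the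
class of stress functions. -/
theorem solvesWProblem_of_bdry (hlm : lam + mu ≠ 0) (hD : IsOpen D)
    (hW : IsBiharmonic D W)
    (hxx : HasBdryValues D (dx (dx W)) fun p => lam * g1 p + (lam + 2 * mu) * g2 p)
    (hyy : HasBdryValues D (dy (dy W)) fun p => (lam + 2 * mu) * g1 p + lam * g2 p) :
    SolvesWProblem lam mu D g1 g2 W := by
  refine ⟨hW, hxx.contCl (hW.continuousOn_dx_dx hD), hyy.contCl (hW.continuousOn_dy_dy hD),
    (hxx.linear hyy (-1 + kappa0 lam mu) (kappa0 lam mu)).congr (fun p _ => ?_) fun p => ?_,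
    (hxx.linear hyy (kappa0 lam mu) (-1 + kappa0 lam mu)).congr (fun p _ => ?_) fun p => ?_⟩
  · rw [C1, lap]
    ring
  · rw [kappa0]
    field_simp
    ring
  · rw [C2, lap]
    ring
  · rw [kappa0]
    field_simp
    ring

theorem SolvesWProblem.exists_displacement (hmu : mu ≠ 0) (hlm : lam + mu ≠ 0) (hD : IsOpen D)
    (hs : IsSimplyConnected D) (h : SolvesWProblem lam mu D g1 g2 W) :
    ∃ u v, SolvesUxVy lam mu D g1 g2 u v ∧ IsAiry lam mu D u v W := by
  obtain ⟨u, v, hd, ha⟩ := h.1.exists_displacement hmu hlm hD hs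
  have hm : 2 * mu ≠ 0 := mul_ne_zero two_ne_zero hmu
  refine ⟨u, v, ⟨hd, ?_, ?_⟩, ha⟩
  -- Only the first term of the combination matters; the second has coefficient zero.
  · refine (h.2.2.2.1.linear h.2.2.2.1 (2 * mu)⁻¹ 0).congr (fun p hp => ?_) fun p => ?_
    · rw [← (ha.rebuilt hlm hp).1, inv_mul_cancel_left₀ hm, zero_mul, add_zero]
    · rw [inv_mul_cancel_left₀ hm, zero_mul, add_zero]
  · refine (h.2.2.2.2.linear h.2.2.2.2 (2 * mu)⁻¹ 0).congr (fun p hp => ?_) fun p => ?_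
    · rw [← (ha.rebuilt hlm hp).2, inv_mul_cancel_left₀ hm, zero_mul, add_zero]
    · rw [inv_mul_cancel_left₀ hm, zero_mul, add_zero]

theorem SolvesUxVy.exists_airy (hmu : mu ≠ 0) (hlm : lam + mu ≠ 0) (hl2m : lam + 2 * mu ≠ 0)
    (hD : IsOpen D) (hs : IsSimplyConnected D) (h : SolvesUxVy lam mu D g1 g2 u v) :
    ∃ W, SolvesWProblem lam mu D g1 g2 W ∧ IsAiry lam mu D u v W := by
  obtain ⟨W, hW, ha⟩ := h.1.exists_airy hmu hl2m hD hs
  exact ⟨W, solvesWProblem_of_bdry hlm hD hW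
    ((h.2.1.linear h.2.2 _ _).congr (fun p hp => (ha p hp).2.1) fun _ => rfl)
    ((h.2.1.linear h.2.2 _ _).congr (fun p hp => (ha p hp).1) fun _ => rfl), ha⟩

theorem SolvesUxVy.contCl (hD : IsOpen D) (h : SolvesUxVy lam mu D g1 g2 u v) :
    ContCl D (dx u) ∧ ContCl D (dy v) :=
  ⟨h.2.1.contCl (contDiffOn_dx hD (m := 1) h.1.1 (by norm_num)).continuousOn,
    h.2.2.contCl (contDiffOn_dy hD (m := 1) h.1.2.1 (by norm_num)).continuousOn⟩

/-- `W` need not be an Airy function of `(u, v)`. But the pair has an Airy function in the same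
class, and `C₁`, `C₂` depend only on `W_xx` and `W_yy`, which uniqueness identifies. -/
theorem rebuiltFromW_of_solves (hmu : mu ≠ 0) (hlm : lam + mu ≠ 0) (hl2m : lam + 2 * mu ≠ 0)
    (hD : IsOpen D) (hDb : Bornology.IsBounded D) (hs : IsSimplyConnected D)
    (hW : SolvesWProblem lam mu D g1 g2 W) (h : SolvesUxVy lam mu D g1 g2 u v) :
    RebuiltFromW lam mu D u v W := by
  obtain ⟨W', hW', ha⟩ := h.exists_airy hmu hlm hl2m hD hs
  obtain ⟨cu, cv⟩ := h.contCl hD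
  have e : ∀ p ∈ D, C1 lam mu W p = C1 lam mu W' p ∧ C2 lam mu W p = C2 lam mu W' p :=
    fun p hp => by
      obtain ⟨e1, e2⟩ := hW.second_derivs_unique hlm hmu hD hDb hW' hp
      rw [C1, C1, C2, C2, lap, lap, e1, e2]
      exact ⟨rfl, rfl⟩
  intro p hp
  constructor
  · have := cu.extendFrom_linear cu (f := C1 lam mu W) (c := 1) (a := 2 * mu) (b := 0) one_ne_zero
      (fun q hq => by rw [(e q hq).1, ← (ha.rebuilt hlm hq).1]; ring) hp
    linarith
  · have := cv.extendFrom_linear cv (f := C2 lam mu W) (c := 1) (a := 2 * mu) (b := 0) one_ne_zero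
      (fun q hq => by rw [(e q hq).2, ← (ha.rebuilt hlm hq).2]; ring) hp
    linarith

/-- The limits of `U₁` and `U₄` at the boundary are inherited from `W_xx` and `W_yy`, so the
relation valid in `D` passes to the closure. -/
theorem rebuiltFromPhi_of_airy (hmu : mu ≠ 0) (hlm : lam + mu ≠ 0)
    (hW : SolvesWProblem lam mu D g1 g2 W) (ha : IsAiry lam mu D u v W)
    (h : SecondDerivs D W Φ) : RebuiltFromPhi lam mu D u v Φ := by
  have hm : 2 * mu ≠ 0 := mul_ne_zero two_ne_zero hmu
  have c1 : ContCl D (U1 Φ) := hW.2.1.congr fun p hp => (h p hp).1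
  have c4 : ContCl D (U4 Φ) := (hW.2.1.linear hW.2.2.1 2⁻¹ (-2⁻¹)).congr fun p hp => by
    rw [(h p hp).1, (h p hp).2]
    ring
  intro p hp
  constructor
  · rw [sub_eq_add_neg, ← neg_mul]
    refine c1.extendFrom_linear c4 hm (fun q hq => ?_) hp
    rw [(ha.rebuilt hlm hq).1, C1, lap, (h q hq).1, (h q hq).2, kappa0]
    field_simp
    ring
  · refine c1.extendFrom_linear c4 hm (fun q hq => ?_) hp
    rw [(ha.rebuilt hlm hq).2, C2, lap, (h q hq).1, (h q hq).2, kappa0]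
    field_simp
    ring

theorem SolvesWProblem.exists_wide14 (hmu : mu ≠ 0) (hlm : lam + mu ≠ 0) (hD : IsOpen D)
    (hs : IsSimplyConnected D) (hW : SolvesWProblem lam mu D g1 g2 W) :
    ∃ Φ, SolvesWide14 D (data1 lam mu g1 g2) (data4 mu g1 g2) Φ ∧ SecondDerivs D W Φ := by
  obtain ⟨Φ, hΦ, h⟩ := hW.1.exists_monogenic hD hs
  refine ⟨Φ, ⟨hΦ, (hW.bdry_dx_dx hlm hmu).congr (fun p hp => (h p hp).1) fun _ => rfl,
    ((hW.bdry_dx_dx hlm hmu).linear (hW.bdry_dy_dy hlm hmu) 2⁻¹ (-2⁻¹)).congr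
      (fun p hp => ?_) fun p => ?_⟩, h⟩
  · rw [(h p hp).1, (h p hp).2]
    ring
  · rw [data4]
    ring

/-- The combination `u₁ - 2u₄ = (λ + 2μ)g₁ + λg₂` is the boundary value that `W_yy` must have. -/
theorem SolvesWide14.exists_solvesWProblem (hlm : lam + mu ≠ 0) (hD : IsOpen D)
    (hs : IsSimplyConnected D) (h : SolvesWide14 D (data1 lam mu g1 g2) (data4 mu g1 g2) Φ) :
    ∃ W, SolvesWProblem lam mu D g1 g2 W ∧ SecondDerivs D W Φ := by
  obtain ⟨W, hW, hΦ⟩ := h.1.exists_isBiharmonic hD hs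
  refine ⟨W, solvesWProblem_of_bdry hlm hD hW
    (h.2.1.congr (fun p hp => (hΦ p hp).1.symm) fun _ => rfl)
    ((h.2.1.linear h.2.2 1 (-2)).congr (fun p hp => ?_) fun p => ?_), hΦ⟩
  · rw [(hΦ p hp).2]
    ring
  · rw [data1, data4]
    ring

theorem SecondDerivs.of_solves (hmu : mu ≠ 0) (hlm : lam + mu ≠ 0) (hD : IsOpen D)
    (hDb : Bornology.IsBounded D) {W' : ℝ × ℝ → ℝ} (h : SecondDerivs D W' Φ)
    (hW' : SolvesWProblem lam mu D g1 g2 W') (hW : SolvesWProblem lam mu D g1 g2 W) :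
    SecondDerivs D W Φ := by
  intro p hp
  obtain ⟨e1, e2⟩ := hW.second_derivs_unique hlm hmu hD hDb hW' hp
  rw [e1, e2]
  exact h p hp

end Problems

end Biharmonic
end

theorem theorem4 (lam mu : ℝ) (hmu : mu ≠ 0) (hlm : lam + mu ≠ 0) (hl2m : lam + 2 * mu ≠ 0)
    (D : Set (ℝ × ℝ)) (hDo : IsOpen D) (hDb : Bornology.IsBounded D)
    (hDs : IsSimplyConnected D) (g1 g2 : ℝ × ℝ → ℝ) :
    -- the general `W` yields the general solution of the displacement problem
    ((∀ W, Biharmonic.SolvesWProblem lam mu D g1 g2 W →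
        ∃ u v, Biharmonic.SolvesUxVy lam mu D g1 g2 u v ∧ Biharmonic.IsAiry lam mu D u v W) ∧
      (∀ u v, Biharmonic.SolvesUxVy lam mu D g1 g2 u v →
        ∃ W, Biharmonic.SolvesWProblem lam mu D g1 g2 W ∧ Biharmonic.IsAiry lam mu D u v W) ∧
      (∀ W u v, Biharmonic.SolvesWProblem lam mu D g1 g2 W →
        Biharmonic.SolvesUxVy lam mu D g1 g2 u v → Biharmonic.RebuiltFromW lam mu D u v W)) ∧
    -- a solution of the (1-4)-problem yields the second derivatives of `W` and the displacements
    (∀ Φ, Biharmonic.Solves14 D (Biharmonic.data1 lam mu g1 g2) (Biharmonic.data4 mu g1 g2) Φ →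
      (∃ W, Biharmonic.SolvesWProblem lam mu D g1 g2 W) ∧
      (∀ W, Biharmonic.SolvesWProblem lam mu D g1 g2 W → Biharmonic.SecondDerivs D W Φ) ∧
      (∃ u v, Biharmonic.SolvesUxVy lam mu D g1 g2 u v) ∧
      (∀ u v, Biharmonic.SolvesUxVy lam mu D g1 g2 u v →
        Biharmonic.RebuiltFromPhi lam mu D u v Φ)) ∧
    -- every `W` and every displacement solution is obtained from some monogenic function
    (∀ W, Biharmonic.SolvesWProblem lam mu D g1 g2 W →
      ∃ Φ, Biharmonic.SolvesWide14 D (Biharmonic.data1 lam mu g1 g2)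
          (Biharmonic.data4 mu g1 g2) Φ ∧ Biharmonic.SecondDerivs D W Φ) ∧
    (∀ u v, Biharmonic.SolvesUxVy lam mu D g1 g2 u v →
      ∃ Φ, Biharmonic.SolvesWide14 D (Biharmonic.data1 lam mu g1 g2)
          (Biharmonic.data4 mu g1 g2) Φ ∧ Biharmonic.RebuiltFromPhi lam mu D u v Φ) := by
  refine ⟨⟨fun W hW => hW.exists_displacement hmu hlm hDo hDs,
    fun u v h => h.exists_airy hmu hlm hl2m hDo hDs,
    fun W u v hW h => Biharmonic.rebuiltFromW_of_solves hmu hlm hl2m hDo hDb hDs hW h⟩,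
    fun Φ hΦ => ?_, fun W hW => hW.exists_wide14 hmu hlm hDo hDs, fun u v h => ?_⟩
  · obtain ⟨W, hW, hWΦ⟩ := hΦ.1.exists_solvesWProblem hlm hDo hDs
    obtain ⟨u, v, huv, -⟩ := hW.exists_displacement hmu hlm hDo hDs
    refine ⟨⟨W, hW⟩, fun W' hW' => hWΦ.of_solves hmu hlm hDo hDb hW hW', ⟨u, v, huv⟩,
      fun u' v' h => ?_⟩
    -- An arbitrary solution has an Airy function `W'` of its own, and by uniqueness `Φ` represents
    -- the second derivatives of `W'` too.
    obtain ⟨W', hW', ha⟩ := h.exists_airy hmu hlm hl2m hDo hDs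
    exact Biharmonic.rebuiltFromPhi_of_airy hmu hlm hW' ha
      (hWΦ.of_solves hmu hlm hDo hDb hW hW')
  · obtain ⟨W, hW, ha⟩ := h.exists_airy hmu hlm hl2m hDo hDs
    obtain ⟨Φ, hΦ, hWΦ⟩ := hW.exists_wide14 hmu hlm hDo hDs
    exact ⟨Φ, hΦ, Biharmonic.rebuiltFromPhi_of_airy hmu hlm hW ha hWΦ⟩
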